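/- Let $\mathcal D$ be a relational schema (finitely many relation names with arities) and let the database domain $\mathcal U$ be a linearly ordered set whose constants are written in an injective coding in which $a\le b$ is decidable in polynomial time. An instance $D$ is a finite set of ground atoms $R(\bar t)$. An integrity constraint is either a functional dependency $X\to Y$ on a relation $R$, or a denial constraint $\forall\bar x\,\neg(A_1\wedge\dots\wedge A_m\wedge\gamma)$, where the $A_i$ are database atoms (with variables and constants), $\gamma$ is a conjunction of comparison atoms ($=,\neq,<,\le,>,\ge$), and every variable of $\bar x$ occurs in some $A_i$. A C-repair of $D$ with respect to a finite set $IC$ of integrity constraints is an instance $D'\models IC$ for which the cardinality $|\Delta(D',D)|$ of the symmetric difference is minimum among all instances that satisfy $IC$. A tuple $\bar t$ is a consistent answer to a query $Q(\bar x)$ in $D$ if $D'\models Q[\bar t]$ for every C-repair $D'$ of $D$. An update sequence $U=U_1,\dots,U_m$ consists of insertions of a tuple, deletions of a tuple, and changes of one attribute value of a tuple; $U(D)$ is the instance obtained by applying the operations in order. For fixed $IC$ and a fixed quantifier-free query $Q(\bar x)$ that is a conjunction of literals (atoms, negated atoms, comparisons), parameterized incremental CQA under C-repairs is the problem $$\{(D,U,\bar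 t)\;:\; D\models IC \text{ and } \bar t \text{ is a consistent answer to } Q \text{ in } U(D)\},$$ with the size $m$ of the update sequence $U$ (its number of operations) as parameter. Theorem. (a) For every finite set $IC$ of functional dependencies and every query $Q$ that is a conjunction of literals, parameterized incremental CQA is fixed-parameter tractable. (b) For every finite set $IC$ of denial constraints and every query $Q$ that is a conjunction of literals, parameterized incremental CQA is fixed-parameter tractable. Here fixed-parameter tractable means: there are one algorithm, a computable function $f:\mathbb N\to\mathbb N$ and a constant $c$ (depending only on $\mathcal D$, the coding of $\mathcal U$, $IC$ and $Q$) such that the algorithm decides every input $(D,U,\bar t)$ in time at most $f(m)\cdot N^c$, where $N$ is the total size of the encoded input. Time is measured on a deterministic machine model polynomially equivalent to Turing machines. -/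

import Mathlib

namespace CQA

/-! ## Machine model

Data are binary trees (LISP-style S-expressions over `nil`), and programs are terms of a small
structured tree-manipulation language in the style of N. Jones' language WHILE.  Every node of a
program that is executed is charged one unit plus the size of the whole tree that it is applied to,
so that no value is ever larger than the time spent to produce it (`Runs.size_le`).  One charged
unit can therefore be simulated on a Turing machine with polynomial overhead, and a Turing machine
can be simulated by a program with polynomial overhead: the notions of polynomial time and of
fixed-parameter tractability below are the usual ones. -/

/-- Binary trees, the data that programs work on. -/
inductive Data : Type
  | nil : Data
  | cons : Data → Data → Data
  deriving DecidableEq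

namespace Data

/-- Number of nodes of a tree. -/
def size : Data → ℕ
  | nil => 1
  | cons a b => 1 + a.size + b.size

/-- First component; `nil` has no components, and `fst nil = nil`. -/
def fst : Data → Data
  | nil => nil
  | cons a _ => a

/-- Second component; `snd nil = nil`. -/
def snd : Data → Data
  | nil => nil
  | cons _ b => b

/-- Test whether the tree is a pair with equal components (`nil` is "no", everything else "yes"). -/
def eqTest : Data → Data
  | nil => nil
  | cons a b => if a = b then cons nil nil else nil

/-- A list of trees as a tree. -/
def ofList : List Data → Data
  | [] => nil
  | a :: l => cons a (ofList l)

/-- A natural number in unary. -/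
def ofNat : ℕ → Data
  | 0 => nil
  | n + 1 => cons nil (ofNat n)

end Data

/-- Programs; each one computes a partial function from trees to trees. -/
inductive Prog : Type
  | id : Prog
  | nil : Prog
  | fst : Prog
  | snd : Prog
  | eq : Prog
  | pair : Prog → Prog → Prog
  | comp : Prog → Prog → Prog
  | ite : Prog → Prog → Prog → Prog
  | while : Prog → Prog → Prog

/-- `Runs p x y t`: program `p`, started on input `x`, halts with output `y` after time `t`.
`comp f g` runs `f` and then `g`; `ite c f g` runs `f` if the test `c` yields a tree other than
`nil`, and `g` otherwise; `while c f` replaces `x` by `f x` as long as the test `c` does not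
yield `nil`. -/
inductive Runs : Prog → Data → Data → ℕ → Prop
  | id (x : Data) : Runs .id x x (1 + x.size)
  | nil (x : Data) : Runs .nil x .nil (1 + x.size)
  | fst (x : Data) : Runs .fst x x.fst (1 + x.size)
  | snd (x : Data) : Runs .snd x x.snd (1 + x.size)
  | eq (x : Data) : Runs .eq x x.eqTest (1 + x.size)
  | pair {f g : Prog} {x y z : Data} {s t : ℕ} :
      Runs f x y s → Runs g x z t → Runs (.pair f g) x (.cons y z) (1 + x.size + s + t)
  | comp {f g : Prog} {x y z : Data} {s t : ℕ} :
      Runs f x y s → Runs g y z t → Runs (.comp f g) x z (1 + x.size + s + t)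
  | ite_true {c f g : Prog} {x b y : Data} {s t : ℕ} :
      Runs c x b s → b ≠ .nil → Runs f x y t → Runs (.ite c f g) x y (1 + x.size + s + t)
  | ite_false {c f g : Prog} {x y : Data} {s t : ℕ} :
      Runs c x .nil s → Runs g x y t → Runs (.ite c f g) x y (1 + x.size + s + t)
  | while_done {c f : Prog} {x : Data} {s : ℕ} :
      Runs c x .nil s → Runs (.while c f) x x (1 + x.size + s)
  | while_step {c f : Prog} {x b y z : Data} {s t u : ℕ} :
      Runs c x b s → b ≠ .nil → Runs f x y t → Runs (.while c f) y z u →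
      Runs (.while c f) x z (1 + x.size + s + t + u)

/-- The machine is deterministic: output and running time are determined by program and input. -/
theorem Runs.det {p : Prog} {x y z : Data} {s t : ℕ} (h₁ : Runs p x y s) (h₂ : Runs p x z t) :
    y = z ∧ s = t := by
  induction h₁ generalizing z t with
  | id | nil | fst | snd | eq => cases h₂; exact ⟨rfl, rfl⟩
  | pair _ _ ih₁ ih₂ =>
    cases h₂ with
    | pair a b => obtain ⟨rfl, rfl⟩ := ih₁ a; obtain ⟨rfl, rfl⟩ := ih₂ b; exact ⟨rfl, rfl⟩
  | comp _ _ ih₁ ih₂ =>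
    cases h₂ with
    | comp a b => obtain ⟨rfl, rfl⟩ := ih₁ a; obtain ⟨rfl, rfl⟩ := ih₂ b; exact ⟨rfl, rfl⟩
  | ite_true _ hb _ ih₁ ih₂ =>
    cases h₂ with
    | ite_true a _ b => obtain ⟨rfl, rfl⟩ := ih₁ a; obtain ⟨rfl, rfl⟩ := ih₂ b; exact ⟨rfl, rfl⟩
    | ite_false a _ => exact absurd (ih₁ a).1 hb
  | ite_false _ _ ih₁ ih₂ =>
    cases h₂ with
    | ite_true a hb _ => exact absurd (ih₁ a).1.symm hb
    | ite_false a b => obtain ⟨-, rfl⟩ := ih₁ a; obtain ⟨rfl, rfl⟩ := ih₂ b; exact ⟨rfl, rfl⟩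
  | while_done _ ih =>
    cases h₂ with
    | while_done a => obtain ⟨-, rfl⟩ := ih a; exact ⟨rfl, rfl⟩
    | while_step a hb _ _ => exact absurd (ih a).1.symm hb
  | while_step _ hb _ _ ih₁ ih₂ ih₃ =>
    cases h₂ with
    | while_done a => exact absurd (ih₁ a).1 hb
    | while_step a _ b c =>
      obtain ⟨rfl, rfl⟩ := ih₁ a
      obtain ⟨rfl, rfl⟩ := ih₂ b
      obtain ⟨rfl, rfl⟩ := ih₃ c
      exact ⟨rfl, rfl⟩

/-- Reading the input and writing the output are paid for. -/
theorem Runs.size_le {p : Prog} {x y : Data} {t : ℕ} (h : Runs p x y t) :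
    x.size ≤ t ∧ y.size ≤ t := by
  induction h with
  | fst x => cases x <;> simp only [Data.fst, Data.size] <;> omega
  | snd x => cases x <;> simp only [Data.snd, Data.size] <;> omega
  | eq x =>
    cases x with
    | nil => simp [Data.eqTest, Data.size]
    | cons a b =>
      have ha : 1 ≤ a.size := by cases a <;> simp only [Data.size] <;> omega
      simp only [Data.eqTest]
      split <;> simp only [Data.size] <;> omega
  | _ => (try simp only [Data.size]); omega

/-- `p` decides the problem `L`, whose inputs `x` are presented as `enc x`, in time `T`: on every
input it halts within time `T x`, with an output other than `nil` exactly on the yes-instances. -/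
def DecidesWithin {α : Type*} (p : Prog) (enc : α → Data) (L : Set α) (T : α → ℕ) : Prop :=
  ∀ x : α, ∃ (y : Data) (t : ℕ), Runs p (enc x) y t ∧ t ≤ T x ∧ (y ≠ .nil ↔ x ∈ L)

/-- Polynomial-time decidable problems. -/
def InPTIME {α : Type*} (enc : α → Data) (L : Set α) : Prop :=
  ∃ (p : Prog) (K c : ℕ), DecidesWithin p enc L (fun x => K * (enc x).size ^ c)

/-- Fixed-parameter tractable problems: the problem `L` with parameter value `κ x` on input `x` is
decided by one program in time `f (κ x) * |x| ^ c`, where `f` is computable, and `f` and `c` do not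
depend on the input. -/
def InFPT {α : Type*} (enc : α → Data) (κ : α → ℕ) (L : Set α) : Prop :=
  ∃ (p : Prog) (f : ℕ → ℕ) (c : ℕ), Computable f ∧
    DecidesWithin p enc L (fun x => f (κ x) * (enc x).size ^ c)

/-! ## Databases -/

/-- A relational schema: finitely many relation names with their arities. -/
structure Schema where
  numRel : ℕ
  arity : Fin numRel → ℕ

/-- A ground atom (database tuple) `R(t̄)`, with constants from the domain `U`. -/
abbrev Fact (S : Schema) (U : Type*) := Σ R : Fin S.numRel, (Fin (S.arity R) → U)

/-- A database instance is a finite set of ground atoms. -/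
abbrev Instance (S : Schema) (U : Type*) := Finset (Fact S U)

/-- Terms over `n` variables: variables and constants. -/
inductive Term (U : Type*) (n : ℕ)
  | var : Fin n → Term U n
  | const : U → Term U n

/-- The value of a term under an assignment to the variables. -/
def Term.eval {U : Type*} {n : ℕ} (v : Fin n → U) : Term U n → U
  | .var i => v i
  | .const a => a

/-- A database atom `R(s₁, …, sₖ)`, whose arguments are terms. -/
structure Atom (S : Schema) (U : Type*) (n : ℕ) where
  rel : Fin S.numRel
  args : Fin (S.arity rel) → Term U n

/-- The ground atom that an assignment makes out of an atom. -/
def Atom.ground {S : Schema} {U : Type*} {n : ℕ} (A : Atom S U n) (v : Fin n → U) : Fact S U :=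
  ⟨A.rel, fun i => (A.args i).eval v⟩

/-- The built-in comparison predicates. -/
inductive CmpOp
  | eq | ne | lt | le | gt | ge

/-- Meaning of the comparison predicates on the ordered domain. -/
def CmpOp.Holds {U : Type*} [LinearOrder U] : CmpOp → U → U → Prop
  | .eq, a, b => a = b
  | .ne, a, b => a ≠ b
  | .lt, a, b => a < b
  | .le, a, b => a ≤ b
  | .gt, a, b => b < a
  | .ge, a, b => b ≤ a

/-- A comparison atom `s θ s'`. -/
structure Comparison (U : Type*) (n : ℕ) where
  op : CmpOp
  lhs : Term U n
  rhs : Term U n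

/-- Truth of a comparison atom under an assignment. -/
def Comparison.Holds {U : Type*} [LinearOrder U] {n : ℕ} (γ : Comparison U n) (v : Fin n → U) :
    Prop :=
  γ.op.Holds (γ.lhs.eval v) (γ.rhs.eval v)

/-! ## Integrity constraints -/

/-- A denial constraint `∀ x̄ ¬(A₁ ∧ … ∧ Aₘ ∧ γ)`, with database atoms `Aᵢ` and a conjunction `γ` of
comparison atoms.  As usual, the quantified variables are those of the database atoms. -/
structure DenialConstraint (S : Schema) (U : Type*) where
  numVars : ℕ
  atoms : List (Atom S U numVars)
  comparisons : List (Comparison U numVars)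
  safe : ∀ x : Fin numVars, ∃ A ∈ atoms, ∃ i, A.args i = .var x

/-- `D ⊨ φ` for a denial constraint `φ`. -/
def DenialConstraint.Holds {S : Schema} {U : Type*} [LinearOrder U] (φ : DenialConstraint S U)
    (D : Instance S U) : Prop :=
  ∀ v : Fin φ.numVars → U,
    ¬ ((∀ A ∈ φ.atoms, A.ground v ∈ D) ∧ ∀ γ ∈ φ.comparisons, γ.Holds v)

/-- A functional dependency `X → Y` between sets of attributes of a relation `R`. -/
structure FunctionalDependency (S : Schema) where
  rel : Fin S.numRel
  lhs : Finset (Fin (S.arity rel))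
  rhs : Finset (Fin (S.arity rel))

/-- `D ⊨ φ` for a functional dependency `φ`: tuples of `R` that agree on `X` agree on `Y`. -/
def FunctionalDependency.Holds {S : Schema} {U : Type*} (φ : FunctionalDependency S)
    (D : Instance S U) : Prop :=
  ∀ s t : Fin (S.arity φ.rel) → U, ⟨φ.rel, s⟩ ∈ D → ⟨φ.rel, t⟩ ∈ D →
    (∀ i ∈ φ.lhs, s i = t i) → ∀ i ∈ φ.rhs, s i = t i

/-! ## Repairs

Integrity constraints enter through the property `IC : Instance S U → Prop` of satisfying them. -/

/-- `D'` is a repair of `D` with respect to `IC` under the repair semantics given by the preorder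
`le D` on instances: `D'` satisfies `IC`, and no instance that satisfies `IC` is strictly below
`D'`. -/
def IsRepair {S : Schema} {U : Type*} (le : Instance S U → Instance S U → Instance S U → Prop)
    (IC : Instance S U → Prop) (D D' : Instance S U) : Prop :=
  IC D' ∧ ¬ ∃ D'' : Instance S U, IC D'' ∧ le D D'' D' ∧ ¬ le D D' D''

/-- The preorder of the C-repair semantics: `D' ≼ D''` iff `|Δ(D', D)| ≤ |Δ(D'', D)|`. -/
def leC {S : Schema} {U : Type*} [DecidableEq U] (D D' D'' : Instance S U) : Prop :=
  (symmDiff D' D).card ≤ (symmDiff D'' D).card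

/-- C-repairs. -/
def IsCRepair {S : Schema} {U : Type*} [DecidableEq U] (IC : Instance S U → Prop)
    (D D' : Instance S U) : Prop :=
  IsRepair leC IC D D'

/-! ## Queries -/

/-- Literals: database atoms, negated database atoms, and comparison atoms (whose negations are
again comparison atoms). -/
inductive Literal (S : Schema) (U : Type*) (n : ℕ)
  | pos : Atom S U n → Literal S U n
  | neg : Atom S U n → Literal S U n
  | cmp : Comparison U n → Literal S U n

/-- Truth of a literal in an instance under an assignment. -/
def Literal.Holds {S : Schema} {U : Type*} [LinearOrder U] {n : ℕ} (D : Instance S U)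
    (v : Fin n → U) : Literal S U n → Prop
  | .pos A => A.ground v ∈ D
  | .neg A => A.ground v ∉ D
  | .cmp γ => γ.Holds v

/-- A query `Q(x₁, …, xₙ)` that is a conjunction of literals, with free variables among
`x₁, …, xₙ`. -/
abbrev Query (S : Schema) (U : Type*) (n : ℕ) := List (Literal S U n)

/-- `D ⊨ Q[t̄]`. -/
def Query.Holds {S : Schema} {U : Type*} [LinearOrder U] {n : ℕ} (Q : Query S U n)
    (D : Instance S U) (t : Fin n → U) : Prop :=
  ∀ L ∈ Q, L.Holds D t

/-- `t̄` is a consistent answer to `Q` in `D` with respect to `IC` under the C-repair semantics. -/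
def IsConsistentAnswer {S : Schema} {U : Type*} [LinearOrder U] {n : ℕ} (IC : Instance S U → Prop)
    (Q : Query S U n) (D : Instance S U) (t : Fin n → U) : Prop :=
  ∀ D' : Instance S U, IsCRepair IC D D' → Q.Holds D' t

/-! ## Updates -/

/-- Update operations: insert a tuple, delete a tuple, or change attribute `A` of a tuple to `a`. -/
inductive Update (S : Schema) (U : Type*)
  | insert : Fact S U → Update S U
  | delete : Fact S U → Update S U
  | change : (t : Fact S U) → (A : Fin (S.arity t.1)) → (a : U) → Update S U

/-- The effect of one operation.  Changing a tuple that is not in the database has no effect. -/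
def Update.apply {S : Schema} {U : Type*} [DecidableEq U] (D : Instance S U) :
    Update S U → Instance S U
  | .insert t => Insert.insert t D
  | .delete t => D.erase t
  | .change t A a =>
      if t ∈ D then Insert.insert ⟨t.1, Function.update t.2 A a⟩ (D.erase t) else D

/-- `U(D)`: the operations of an update sequence are applied from the first to the last. -/
def applyUpdates {S : Schema} {U : Type*} [DecidableEq U] (D : Instance S U)
    (u : List (Update S U)) : Instance S U :=
  u.foldl Update.apply D

/-! ## Incremental consistent query answering -/

/-- An input `(D, U, t̄)`; the database is presented by a list of its tuples, in any
order and possibly with repetitions. -/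
structure Input (S : Schema) (U : Type*) (n : ℕ) where
  db : List (Fact S U)
  updates : List (Update S U)
  answer : Fin n → U

/-- Parameterized incremental CQA for `Q` and `IC` under the C-repair semantics: the triples
`(D, U, t̄)` where `D` is consistent and `t̄` is a consistent answer to `Q` in `U(D)`. -/
def incrementalCQA {S : Schema} {U : Type*} [LinearOrder U] {n : ℕ} (IC : Instance S U → Prop)
    (Q : Query S U n) : Set (Input S U n) :=
  {x | IC x.db.toFinset ∧ IsConsistentAnswer IC Q (applyUpdates x.db.toFinset x.updates) x.answer}

/-- The parameter: the size of the update sequence, that is, its number of operations. -/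
def numUpdates {S : Schema} {U : Type*} {n : ℕ} (x : Input S U n) : ℕ :=
  x.updates.length

/-! ## Presentation of inputs as trees, for a given coding of the constants -/

/-- A tuple of constants as a tree. -/
def encTuple {U : Type*} (code : U → Data) {k : ℕ} (t : Fin k → U) : Data :=
  .ofList (List.ofFn fun i => code (t i))

/-- A ground atom as a tree. -/
def encFact {S : Schema} {U : Type*} (code : U → Data) (t : Fact S U) : Data :=
  .cons (.ofNat t.1) (encTuple code t.2)

/-- An update operation as a tree, tagged by its kind. -/
def encUpdate {S : Schema} {U : Type*} (code : U → Data) : Update S U → Data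
  | .insert t => .cons (.ofNat 0) (encFact code t)
  | .delete t => .cons (.ofNat 1) (encFact code t)
  | .change t A a => .cons (.ofNat 2) (.cons (encFact code t) (.cons (.ofNat A) (code a)))

/-- An input `(D, U, t̄)` as a tree. -/
def encInput {S : Schema} {U : Type*} (code : U → Data) {n : ℕ} (x : Input S U n) : Data :=
  .cons (.ofList (x.db.map (encFact code)))
    (.cons (.ofList (x.updates.map (encUpdate code))) (encTuple code x.answer))

/-- A pair of constants as a tree. -/
def encPair {U : Type*} (code : U → Data) (x : U × U) : Data :=
  .cons (code x.1) (code x.2)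

end CQA

namespace CQA

/-! The proof is a bounded search tree. A violation of a denial constraint is a bounded set of facts
that are all present (a conflict), so every consistent instance omits a fact of each conflict.
Branch on which fact of a chosen conflict to delete. The branching degree depends only on the
constraints, and a node at depth `i` has lost exactly `i` facts. For any consistent `D`, some branch
deletes only facts outside `D` for as long as its nodes are inconsistent
(`exists_mem_level_superset`). Hence the first depth `k` with a consistent node is at most the
number of facts to be repaired that lie outside `D` (`exists_first_level`), and the consistent nodes
at depth `k` are exactly the C-repairs (`isCRepair_iff_mem_level`).

The original database is consistent, and each update adds at most one fact, so `k ≤ m`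
(`card_applyUpdates_sdiff_le`). There are therefore at most `d ^ k` nodes to inspect, with `d` a
constant, and at each of them consistency and the query are checked in polynomial time. A functional
dependency is equivalent to finitely many denial constraints, one for each attribute on its
right-hand side.

For running times, `Tractable` is closed under composition, pairing, case distinction and loops with
controlled round count and state size. Explicit programs are thus replaced by closure arguments, and
`tractable_incrementalCQA` combines these with the search tree. -/

theorem Data.size_pos (d : Data) : 1 ≤ d.size := by
  cases d <;> simp only [Data.size] <;> omega

/-! ## Fixed-parameter tractable bounds -/

/-- `T` is bounded by a single exponential in the parameter times a polynomial in the size of the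
presentation. -/
def FPBound {α : Type*} (κ : α → ℕ) (e : α → Data) (T : α → ℕ) : Prop :=
  ∃ A B c : ℕ, ∀ a, T a ≤ A * B ^ κ a * (e a).size ^ c

namespace FPBound

variable {α β : Type*} {κ : α → ℕ} {e : α → Data} {T T' : α → ℕ}

theorem mono (h : FPBound κ e T) (hT : ∀ a, T' a ≤ T a) : FPBound κ e T' := by
  obtain ⟨A, B, c, h⟩ := h
  exact ⟨A, B, c, fun a => (hT a).trans (h a)⟩

theorem const (n : ℕ) : FPBound κ e (fun _ => n) := ⟨n, 1, 0, fun _ => by simp⟩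

theorem size : FPBound κ e (fun a => (e a).size) := ⟨1, 1, 1, fun _ => by simp⟩

theorem pow_param (n : ℕ) : FPBound κ e (fun a => n ^ κ a) := ⟨1, n, 0, fun _ => by simp⟩

theorem param : FPBound κ e κ :=
  (pow_param 2).mono fun _ => Nat.lt_two_pow_self.le

theorem add (h : FPBound κ e T) (h' : FPBound κ e T') : FPBound κ e (fun a => T a + T' a) := by
  obtain ⟨A, B, c, h⟩ := h
  obtain ⟨A', B', c', h'⟩ := h'
  refine ⟨A + A', B + B', c + c', fun a => ?_⟩
  -- Sizes are at least 1, so the exponents `c` and `c'` may both be raised to `c + c'`.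
  have hs := (e a).size_pos
  calc T a + T' a ≤ A * B ^ κ a * (e a).size ^ c + A' * B' ^ κ a * (e a).size ^ c' :=
        Nat.add_le_add (h a) (h' a)
    _ ≤ A * (B + B') ^ κ a * (e a).size ^ (c + c') +
        A' * (B + B') ^ κ a * (e a).size ^ (c + c') := by
        gcongr <;> omega
    _ = _ := by ring

theorem mul (h : FPBound κ e T) (h' : FPBound κ e T') : FPBound κ e (fun a => T a * T' a) := by
  obtain ⟨A, B, c, h⟩ := h
  obtain ⟨A', B', c', h'⟩ := h'
  refine ⟨A * A', B * B', c + c', fun a => ?_⟩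
  calc T a * T' a ≤ (A * B ^ κ a * (e a).size ^ c) * (A' * B' ^ κ a * (e a).size ^ c') :=
        Nat.mul_le_mul (h a) (h' a)
    _ = _ := by ring

theorem pow (h : FPBound κ e T) (n : ℕ) : FPBound κ e (fun a => T a ^ n) := by
  induction n with
  | zero => simpa using const 1
  | succ n ih => simpa only [pow_succ] using ih.mul h

theorem comp {κ' : β → ℕ} {e' : β → Data} {T' : β → ℕ} (h : FPBound κ' e' T') (f : α → β)
    (hκ : ∀ a, κ' (f a) ≤ κ a) (hs : FPBound κ e (fun a => (e' (f a)).size)) :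
    FPBound κ e (fun a => T' (f a)) := by
  obtain ⟨A, B, c, h⟩ := h
  -- The base `B + 1` is positive even if `B = 0`, so its powers are monotone in the parameter.
  refine (((const A).mul (pow_param (B + 1))).mul (hs.pow c)).mono fun a => (h _).trans ?_
  refine Nat.mul_le_mul_right _ (Nat.mul_le_mul_left _ ?_)
  exact (Nat.pow_le_pow_left (Nat.le_succ B) _).trans (Nat.pow_le_pow_right (Nat.succ_pos B) (hκ a))

end FPBound

/-! ## Tractable functions -/

/-- One program computes `g a` from the presentation `e a`, for all `a`, within a fixed-parameter
tractable time bound for the parameter `κ`. -/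
def Tractable {α : Type*} (κ : α → ℕ) (e g : α → Data) : Prop :=
  ∃ (p : Prog) (T : α → ℕ), FPBound κ e T ∧ ∀ a, ∃ t ≤ T a, Runs p (e a) (g a) t

/-- Polynomial-time computability of `g a` from the presentation `e a`. -/
abbrev PolyTime {α : Type*} (e g : α → Data) : Prop := Tractable (fun _ => 0) e g

namespace Tractable

variable {α β : Type*} {κ : α → ℕ} {e g h : α → Data}

/-- Writing the output is charged for. This is what keeps the second stage of a composition within
the bound, since its time is measured in the size of the intermediate value. -/
theorem size_bound (hg : Tractable κ e g) : FPBound κ e (fun a => (g a).size) := by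
  obtain ⟨p, T, hT, hp⟩ := hg
  refine hT.mono fun a => ?_
  obtain ⟨t, ht, hr⟩ := hp a
  exact hr.size_le.2.trans ht

theorem id : Tractable κ e e :=
  ⟨.id, fun a => 1 + (e a).size, (FPBound.const 1).add .size, fun _ => ⟨_, le_rfl, .id _⟩⟩

theorem nil : Tractable κ e (fun _ => .nil) :=
  ⟨.nil, fun a => 1 + (e a).size, (FPBound.const 1).add .size, fun _ => ⟨_, le_rfl, .nil _⟩⟩

theorem comp {κ' : β → ℕ} {e' h : β → Data} {f : α → β} (hh : Tractable κ' e' h)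
    (hf : Tractable κ e (fun a => e' (f a))) (hκ : ∀ a, κ' (f a) ≤ κ a) :
    Tractable κ e (fun a => h (f a)) := by
  have hs := hf.size_bound
  obtain ⟨p, T, hT, hp⟩ := hf
  obtain ⟨q, T', hT', hq⟩ := hh
  refine ⟨.comp p q, fun a => 1 + (e a).size + T a + T' (f a),
    (((FPBound.const 1).add .size).add hT).add (hT'.comp f hκ hs), fun a => ?_⟩
  obtain ⟨t, ht, hr⟩ := hp a
  obtain ⟨t', ht', hr'⟩ := hq (f a)
  exact ⟨_, by dsimp only; omega, hr.comp hr'⟩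

/-- Restriction to a family of inputs. -/
theorem reindex (hg : PolyTime e g) (r : β → α) :
    PolyTime (fun b => e (r b)) (fun b => g (r b)) :=
  hg.comp id fun _ => le_rfl

theorem of_polyTime (hg : PolyTime e g) : Tractable κ e g :=
  comp (f := fun a => a) hg id fun _ => Nat.zero_le _

theorem fst (hg : Tractable κ e g) : Tractable κ e (fun a => (g a).fst) :=
  comp (κ' := fun _ => 0) (h := Data.fst)
    ⟨.fst, fun d => 1 + d.size, (FPBound.const 1).add .size, fun _ => ⟨_, le_rfl, .fst _⟩⟩
    (e' := fun d => d) (f := g) hg fun _ => Nat.zero_le _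

theorem snd (hg : Tractable κ e g) : Tractable κ e (fun a => (g a).snd) :=
  comp (κ' := fun _ => 0) (h := Data.snd)
    ⟨.snd, fun d => 1 + d.size, (FPBound.const 1).add .size, fun _ => ⟨_, le_rfl, .snd _⟩⟩
    (e' := fun d => d) (f := g) hg fun _ => Nat.zero_le _

theorem eqTest (hg : Tractable κ e g) : Tractable κ e (fun a => (g a).eqTest) :=
  comp (κ' := fun _ => 0) (h := Data.eqTest)
    ⟨.eq, fun d => 1 + d.size, (FPBound.const 1).add .size, fun _ => ⟨_, le_rfl, .eq _⟩⟩
    (e' := fun d => d) (f := g) hg fun _ => Nat.zero_le _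

theorem pair (hg : Tractable κ e g) (hh : Tractable κ e h) :
    Tractable κ e (fun a => .cons (g a) (h a)) := by
  obtain ⟨p, T, hT, hp⟩ := hg
  obtain ⟨q, T', hT', hq⟩ := hh
  refine ⟨.pair p q, fun a => 1 + (e a).size + T a + T' a,
    (((FPBound.const 1).add .size).add hT).add hT', fun a => ?_⟩
  obtain ⟨t, ht, hr⟩ := hp a
  obtain ⟨t', ht', hr'⟩ := hq a
  exact ⟨_, by dsimp only; omega, hr.pair hr'⟩

theorem const (d : Data) : Tractable κ e (fun _ => d) := by
  induction d with
  | nil => exact nil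
  | cons a b iha ihb => exact iha.pair ihb

/-- Case distinction: each branch only has to work on the inputs that reach it. -/
theorem ite {c : α → Data} (hc : Tractable κ e c)
    (hg : Tractable (fun a : {a // c a ≠ .nil} => κ a) (fun a => e a) (fun a => g a))
    (hh : Tractable (fun a : {a // c a = .nil} => κ a) (fun a => e a) (fun a => g a)) :
    Tractable κ e g := by
  classical
  obtain ⟨r, R, hR, hr⟩ := hc
  obtain ⟨p, T, ⟨A, B, c₁, hT⟩, hp⟩ := hg
  obtain ⟨q, T', ⟨A', B', c₂, hT'⟩, hq⟩ := hh
  -- The branch times `T` and `T'` are defined only on their own inputs; the explicit bounds make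
  -- sense on all of them.
  have h1 : FPBound κ e (fun a => A * B ^ κ a * (e a).size ^ c₁) := ⟨A, B, c₁, fun _ => le_rfl⟩
  have h2 : FPBound κ e (fun a => A' * B' ^ κ a * (e a).size ^ c₂) := ⟨A', B', c₂, fun _ => le_rfl⟩
  refine ⟨.ite r p q, _, ((((FPBound.const 1).add .size).add hR).add h1).add h2, fun a => ?_⟩
  obtain ⟨t, ht, hrun⟩ := hr a
  by_cases hca : c a = .nil
  · obtain ⟨t', ht', hrun'⟩ := hq ⟨a, hca⟩
    have := hT' ⟨a, hca⟩
    rw [hca] at hrun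
    exact ⟨_, by dsimp only at *; omega, .ite_false hrun hrun'⟩
  · obtain ⟨t', ht', hrun'⟩ := hp ⟨a, hca⟩
    have := hT ⟨a, hca⟩
    exact ⟨_, by dsimp only at *; omega, .ite_true hrun hca hrun'⟩

theorem congr (hg : Tractable κ e g) (hgh : ∀ a, g a = h a) : Tractable κ e h := by
  rwa [← funext hgh]

end Tractable

/-- A round costs one test, one body and the charge `1 + size` for the loop node. The size is at
most the time of the test, whence `1 + 3 * T`; the extra round is the final, failing test. -/
theorem Runs.exists_while {c f : Prog} {x : ℕ → Data} {k T : ℕ}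
    (hc : ∀ i < k, ∃ b, b ≠ .nil ∧ ∃ t ≤ T, Runs c (x i) b t)
    (hf : ∀ i < k, ∃ t ≤ T, Runs f (x i) (x (i + 1)) t)
    (hk : ∃ t ≤ T, Runs c (x k) .nil t) :
    ∃ t ≤ (k + 1) * (1 + 3 * T), Runs (.while c f) (x 0) (x k) t := by
  induction k generalizing x with
  | zero =>
    obtain ⟨t, ht, hr⟩ := hk
    have := hr.size_le.1
    exact ⟨_, by omega, .while_done hr⟩
  | succ k ih =>
    obtain ⟨b, hb, s, hs, hrs⟩ := hc 0 k.succ_pos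
    obtain ⟨t, ht, hrt⟩ := hf 0 k.succ_pos
    obtain ⟨u, hu, hru⟩ := ih (x := fun i => x (i + 1)) (fun i hi => hc (i + 1) (by omega))
      (fun i hi => hf (i + 1) (by omega)) hk
    have := hrs.size_le.1
    refine ⟨_, ?_, .while_step hrs hb hrt hru⟩
    rw [add_mul (k + 1) 1]
    omega

/-- Loops with a bounded number of rounds through states of bounded size. -/
theorem Tractable.while {α : Type*} {κ : α → ℕ} {e : α → Data} (x : α → ℕ → Data) (k : α → ℕ)
    (test : α → ℕ → Data) (M : α → ℕ)
    (h0 : Tractable κ e (fun a => x a 0)) (hk : FPBound κ e k) (hM : FPBound κ e M)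
    (hx : ∀ a, ∀ i ≤ k a, (x a i).size ≤ M a)
    (hc : PolyTime (fun p : {p : α × ℕ // p.2 ≤ k p.1} => x p.1.1 p.1.2)
      (fun p => test p.1.1 p.1.2))
    (hne : ∀ a, ∀ i < k a, test a i ≠ .nil) (hnil : ∀ a, test a (k a) = .nil)
    (hf : PolyTime (fun p : {p : α × ℕ // p.2 < k p.1} => x p.1.1 p.1.2)
      (fun p => x p.1.1 (p.1.2 + 1))) :
    Tractable κ e (fun a => x a (k a)) := by
  have hM0 := h0.size_bound
  obtain ⟨p₀, T₀, hT₀, hp₀⟩ := h0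
  obtain ⟨p, T, ⟨A, B, m, hT⟩, hp⟩ := hc
  obtain ⟨q, T', ⟨A', B', m', hT'⟩, hq⟩ := hf
  -- Test and body are polynomial in the current state, so the parameter enters a round only through
  -- the size bound `M`.
  have hR : FPBound κ e (fun a => A * M a ^ m + A' * M a ^ m') :=
    ((FPBound.const A).mul (hM.pow m)).add ((FPBound.const A').mul (hM.pow m'))
  refine ⟨.comp p₀ (.while p q), _, (((FPBound.const 1).add .size).add hT₀).add
    ((hk.add (.const 1)).mul ((FPBound.const 1).add ((FPBound.const 3).mul hR))), fun a => ?_⟩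
  have hp' : ∀ i ≤ k a, ∃ t ≤ A * M a ^ m + A' * M a ^ m', Runs p (x a i) (test a i) t := by
    intro i hi
    obtain ⟨t, ht, hr⟩ := hp ⟨(a, i), hi⟩
    have h1 := hT ⟨(a, i), hi⟩
    have h2 := Nat.mul_le_mul_left A (Nat.pow_le_pow_left (hx a i hi) m)
    simp only [pow_zero, mul_one] at h1
    exact ⟨t, by omega, hr⟩
  obtain ⟨t₀, ht₀, hr₀⟩ := hp₀ a
  obtain ⟨t, ht, hr⟩ := Runs.exists_while (c := p) (f := q) (x := x a) (k := k a)
    (fun i hi => ⟨_, hne a i hi, hp' i hi.le⟩) (fun i hi => by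
      obtain ⟨t, ht, hr⟩ := hq ⟨(a, i), hi⟩
      have h1 := hT' ⟨(a, i), hi⟩
      have h2 := Nat.mul_le_mul_left A' (Nat.pow_le_pow_left (hx a i hi.le) m')
      simp only [pow_zero, mul_one] at h1
      exact ⟨t, by omega, hr⟩) (by simpa only [hnil] using hp' (k a) le_rfl)
  exact ⟨_, by omega, hr₀.comp hr⟩

/-! ## Decidable properties -/

open Classical in
/-- A truth value as a tree. -/
noncomputable def truth (P : Prop) : Data := if P then .cons .nil .nil else .nil

@[simp] theorem truth_eq_nil {P : Prop} : truth P = .nil ↔ ¬ P := by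
  unfold truth; split <;> simp_all

theorem truth_of {P : Prop} (h : P) : truth P = .cons .nil .nil := if_pos h

theorem truth_of_not {P : Prop} (h : ¬ P) : truth P = .nil := if_neg h

namespace Tractable

variable {α : Type*} {κ : α → ℕ} {e g h : α → Data} {P P' : α → Prop}

/-- A case distinction normalises an arbitrary non-`nil` answer to the fixed tree used by `truth`.
-/
theorem truth_of_iff (hg : Tractable κ e g) (hP : ∀ a, g a ≠ .nil ↔ P a) :
    Tractable κ e (fun a => truth (P a)) :=
  ite hg ((const (.cons .nil .nil)).congr fun a => (truth_of ((hP a).1 a.2)).symm)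
    (nil.congr fun a => (truth_of_not fun hp => (hP a).2 hp a.2).symm)

theorem not (hP : Tractable κ e (fun a => truth (P a))) :
    Tractable κ e (fun a => truth (¬ P a)) :=
  ite hP (nil.congr fun a => (truth_of_not fun hn => a.2 (truth_of_not hn)).symm)
    ((const (.cons .nil .nil)).congr fun a => (truth_of (truth_eq_nil.1 a.2)).symm)

theorem and (hP : Tractable κ e (fun a => truth (P a)))
    (hP' : Tractable κ e (fun a => truth (P' a))) :
    Tractable κ e (fun a => truth (P a ∧ P' a)) := by
  refine ite hP ?_ (nil.congr fun a => (truth_of_not fun hn => truth_eq_nil.1 a.2 hn.1).symm)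
  refine Tractable.congr (g := fun a : {a // truth (P a) ≠ .nil} => truth (P' a)) ?_ fun a => ?_
  · exact comp (f := Subtype.val) hP' id fun _ => le_rfl
  · have : P a := by simpa using a.2
    simp [this]

theorem eq (hg : Tractable κ e g) (hh : Tractable κ e h) :
    Tractable κ e (fun a => truth (g a = h a)) :=
  (hg.pair hh).eqTest.truth_of_iff fun a => by simp [Data.eqTest]

theorem all {ι : Type*} {P : α → ι → Prop} (l : List ι)
    (hP : ∀ i ∈ l, Tractable κ e (fun a => truth (P a i))) :
    Tractable κ e (fun a => truth (∀ i ∈ l, P a i)) := by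
  induction l with
  | nil => exact (const (.cons .nil .nil)).congr fun a => (truth_of (by simp)).symm
  | cons i l ih =>
    simp only [List.forall_mem_cons]
    simp only [List.forall_mem_cons] at hP
    exact hP.1.and (ih hP.2)

end Tractable

end CQA

namespace CQA

/-! ## Lists -/

/-- A list as a tree, for a given presentation of its elements. -/
def encList {α : Type*} (e : α → Data) (l : List α) : Data := .ofList (l.map e)

@[simp] theorem encList_nil {α : Type*} (e : α → Data) : encList e [] = .nil := rfl

@[simp] theorem encList_cons {α : Type*} (e : α → Data) (a : α) (l : List α) :
    encList e (a :: l) = .cons (e a) (encList e l) := rfl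

theorem encList_eq_nil {α : Type*} {e : α → Data} {l : List α} : encList e l = .nil ↔ l = [] := by
  cases l <;> simp

theorem size_encList_le {α : Type*} {e : α → Data} {l : List α} {M : ℕ}
    (h : ∀ a ∈ l, (e a).size ≤ M) : (encList e l).size ≤ l.length * (M + 1) + 1 := by
  induction l with
  | nil => simp [Data.size]
  | cons a l ih =>
    simp only [List.forall_mem_cons] at h
    have := ih h.2
    have := h.1
    simp only [encList_cons, Data.size, List.length_cons, add_mul]
    omega

theorem length_le_size_encList {α : Type*} (e : α → Data) (l : List α) :
    l.length ≤ (encList e l).size := by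
  induction l with
  | nil => simp
  | cons a l ih => simp only [encList_cons, Data.size, List.length_cons]; omega

theorem size_encList_le_of_sublist {α : Type*} (e : α → Data) {l l' : List α}
    (h : l.Sublist l') : (encList e l).size ≤ (encList e l').size := by
  induction h with
  | slnil => exact le_rfl
  | cons a _ ih => simp only [encList_cons, Data.size]; omega
  | cons_cons a _ ih => simp only [encList_cons, Data.size]; omega

theorem size_le_size_encList {α : Type*} (e : α → Data) {a : α} {l : List α} (h : a ∈ l) :
    (e a).size ≤ (encList e l).size := by
  have := size_encList_le_of_sublist e (List.singleton_sublist.2 h)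
  simp only [encList_cons, Data.size] at this
  omega

theorem size_encList_append_add_one {α : Type*} (e : α → Data) (l l' : List α) :
    (encList e (l ++ l')).size + 1 = (encList e l).size + (encList e l').size := by
  induction l with
  | nil => simp [Data.size]; omega
  | cons a l ih => simp only [List.cons_append, encList_cons, Data.size]; omega

theorem size_encList_reverse {α : Type*} (e : α → Data) (l : List α) :
    (encList e l.reverse).size = (encList e l).size := by
  induction l with
  | nil => rfl
  | cons a l ih =>
    have := size_encList_append_add_one e l.reverse [a]
    simp only [List.reverse_cons, encList_cons, encList_nil, Data.size] at *
    omega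

namespace Tractable

variable {α β γ σ : Type*} {e : α → Data} {eb : β → Data} {ec : γ → Data}

/-- The loop state holds the input, the unread rest of the list and the accumulator. Iterating a
polynomial-time step may make values grow exponentially, so a bound on the accumulator after every
prefix has to be supplied. -/
theorem foldl {es : σ → Data} {l : α → List β} {s₀ : α → σ} {step : α → β → σ → σ} {M : α → ℕ}
    (hl : PolyTime e (fun a => encList eb (l a))) (hs₀ : PolyTime e (fun a => es (s₀ a)))
    (hstep : PolyTime (fun p : α × β × σ => .cons (e p.1) (.cons (eb p.2.1) (es p.2.2)))
      (fun p => es (step p.1 p.2.1 p.2.2)))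
    (hM : FPBound (fun _ => 0) e M)
    (hsize : ∀ a l₁, l₁ <+: l a → (es (l₁.foldl (fun s b => step a b s) (s₀ a))).size ≤ M a) :
    PolyTime e (fun a => es ((l a).foldl (fun s b => step a b s) (s₀ a))) := by
  let st : α → ℕ → σ := fun a i => ((l a).take i).foldl (fun s b => step a b s) (s₀ a)
  have key : PolyTime e (fun a => .cons (e a)
      (.cons (encList eb ((l a).drop (l a).length)) (es (st a (l a).length)))) := by
    refine Tractable.while
      (fun a i => .cons (e a) (.cons (encList eb ((l a).drop i)) (es (st a i))))
      (fun a => (l a).length) (fun a i => encList eb ((l a).drop i))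
      (fun a => 2 + (e a).size + (encList eb (l a)).size + M a) (id.pair (hl.pair hs₀))
      (hl.size_bound.mono fun a => length_le_size_encList _ _)
      ((((FPBound.const 2).add .size).add hl.size_bound).add hM)
      (fun a i _ => ?_) id.snd.fst
      (fun a i hi => by simpa [encList_eq_nil] using hi) (fun a => by simp) ?_
    · have h1 := size_encList_le_of_sublist eb (List.drop_sublist i (l a))
      have h2 := hsize a _ (List.take_prefix i (l a))
      simp only [Data.size, st]
      omega
    · have hd : ∀ p : {p : α × ℕ // p.2 < (l p.1).length},
          (l p.1.1).drop p.1.2 = (l p.1.1)[p.1.2]'p.2 :: (l p.1.1).drop (p.1.2 + 1) :=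
        fun p => List.drop_eq_getElem_cons p.2
      refine id.fst.pair (pair ?_ ?_)
      · exact id.snd.fst.snd.congr fun p => by simp only [hd p, encList_cons, Data.fst, Data.snd]
      · have := hstep.comp (κ := fun _ => 0)
          (e := fun p : {p : α × ℕ // p.2 < (l p.1).length} =>
            .cons (e p.1.1) (.cons (encList eb ((l p.1.1).drop p.1.2)) (es (st p.1.1 p.1.2))))
          (f := fun p => (p.1.1, (l p.1.1)[p.1.2]'p.2, st p.1.1 p.1.2))
          ((id.fst.pair (id.snd.fst.fst.pair id.snd.snd)).congr fun p => by
            simp only [hd p, encList_cons, Data.fst, Data.snd]) (fun _ => le_rfl)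
        exact this.congr fun p => by
          simp only [st, List.take_succ_eq_append_getElem p.2, List.foldl_append, List.foldl_cons,
            List.foldl_nil]
  exact key.snd.snd.congr fun a => by simp [st, Data.snd]

theorem reverseAux {l l' : α → List β} (hl : PolyTime e (fun a => encList eb (l a)))
    (hl' : PolyTime e (fun a => encList eb (l' a))) :
    PolyTime e (fun a => encList eb ((l a).reverse ++ l' a)) := by
  have := foldl (es := encList eb) (step := fun _ b s => b :: s) hl hl' (id.snd.fst.pair id.snd.snd)
    (hl.size_bound.add hl'.size_bound) (fun a l₁ h => by
      have h1 := size_encList_le_of_sublist eb h.sublist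
      have h2 := size_encList_append_add_one eb l₁.reverse (l' a)
      rw [size_encList_reverse] at h2
      simp only [List.foldl_flip_cons_eq_append, List.map_id']
      omega)
  exact this.congr fun a => by simp only [List.foldl_flip_cons_eq_append, List.map_id']

theorem reverse {l : α → List β} (hl : PolyTime e (fun a => encList eb (l a))) :
    PolyTime e (fun a => encList eb (l a).reverse) :=
  (reverseAux (l' := fun _ => []) hl nil).congr fun a => by simp

theorem append {l l' : α → List β} (hl : PolyTime e (fun a => encList eb (l a)))
    (hl' : PolyTime e (fun a => encList eb (l' a))) :
    PolyTime e (fun a => encList eb (l a ++ l' a)) :=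
  (reverseAux hl.reverse hl').congr fun a => by simp

theorem flatMap {l : α → List β} {g : α → β → List γ}
    (hl : PolyTime e (fun a => encList eb (l a)))
    (hg : PolyTime (fun p : α × β => .cons (e p.1) (eb p.2)) (fun p => encList ec (g p.1 p.2))) :
    PolyTime e (fun a => encList ec ((l a).flatMap (g a))) := by
  -- The fold builds the output backwards; one final reversal restores the order.
  have hfold : ∀ a (l : List β) (s : List γ), l.foldl (fun s b => (g a b).reverse ++ s) s =
      (l.flatMap (g a)).reverse ++ s := by
    intro a l
    induction l with
    | nil => simp
    | cons b l ih => intro s; simp [ih]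
  obtain ⟨A, B, c, hb⟩ := hg.size_bound
  -- A common size bound for all blocks `g a b`, since each `b` is no larger than the whole list.
  let N : α → ℕ := fun a => A * (1 + (e a).size + (encList eb (l a)).size) ^ c
  have hN : FPBound (fun _ => 0) e N := (FPBound.const A).mul
    ((((FPBound.const 1).add .size).add hl.size_bound).pow c)
  have hsz : ∀ a (l₁ : List β), l₁ ⊆ l a →
      (encList ec (l₁.flatMap (g a))).size ≤ l₁.length * N a + 1 := by
    intro a l₁
    induction l₁ with
    | nil => simp [Data.size]
    | cons b l₁ ih =>
      intro hsub
      have h1 := ih fun x hx => hsub (List.mem_cons_of_mem _ hx)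
      have h2 := size_encList_append_add_one ec (g a b) (l₁.flatMap (g a))
      have h3 := hb (a, b)
      have h4 := size_le_size_encList eb (hsub (List.mem_cons_self ..))
      have h5 : (Data.cons (e a) (eb b)).size ≤ 1 + (e a).size + (encList eb (l a)).size := by
        simp only [Data.size]; omega
      have h6 := Nat.mul_le_mul_left A (Nat.pow_le_pow_left h5 c)
      simp only [pow_zero, mul_one] at h3
      simp only [List.flatMap_cons, List.length_cons, add_mul, N] at *
      omega
  have := foldl (eb := eb) (es := encList ec) (s₀ := fun _ => [])
    (step := fun a b s => (g a b).reverse ++ s) hl nil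
    (reverseAux (hg.comp (f := fun p : α × β × List γ => (p.1, p.2.1))
      (id.fst.pair id.snd.fst) fun _ => le_rfl) id.snd.snd)
    ((hl.size_bound.mul hN).add (.const 1)) (fun a l₁ h => by
      rw [hfold, List.append_nil, size_encList_reverse]
      refine (hsz a l₁ h.subset).trans ?_
      have := h.length_le.trans (length_le_size_encList eb (l a))
      gcongr)
  exact (reverse (l := fun a => (l a).foldl (fun s b => (g a b).reverse ++ s) []) this).congr
    fun a => by simp [hfold]

theorem map {l : α → List β} {g : α → β → γ} (hl : PolyTime e (fun a => encList eb (l a)))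
    (hg : PolyTime (fun p : α × β => .cons (e p.1) (eb p.2)) (fun p => ec (g p.1 p.2))) :
    PolyTime e (fun a => encList ec ((l a).map (g a))) :=
  (flatMap (g := fun a b => [g a b]) hl (hg.pair nil)).congr fun a => by
    rw [List.map_eq_flatMap]

theorem filter {l : α → List β} {P : α → β → Prop} [∀ a b, Decidable (P a b)]
    (hl : PolyTime e (fun a => encList eb (l a)))
    (hP : PolyTime (fun p : α × β => .cons (e p.1) (eb p.2)) (fun p => truth (P p.1 p.2))) :
    PolyTime e (fun a => encList eb ((l a).filter fun b => P a b)) := by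
  refine (flatMap (ec := eb) (g := fun a b => if P a b then [b] else []) hl (hP.ite ?_ ?_)).congr fun a => ?_
  · refine (id.snd.pair nil).congr fun p => ?_
    have := p.2
    simp only [ne_eq, truth_eq_nil, not_not] at this
    simp [this, Data.snd]
  · refine nil.congr fun p => ?_
    have := p.2
    simp only [truth_eq_nil] at this
    simp [this]
  · congr 1
    induction l a with
    | nil => rfl
    | cons b l ih => by_cases h : P a b <;> simp [h, ih]

theorem exists_mem {l : α → List β} {P : α → β → Prop}
    (hl : PolyTime e (fun a => encList eb (l a)))
    (hP : PolyTime (fun p : α × β => .cons (e p.1) (eb p.2)) (fun p => truth (P p.1 p.2))) :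
    PolyTime e (fun a => truth (∃ b ∈ l a, P a b)) := by
  classical
  exact (filter hl hP).truth_of_iff fun a => by simp [encList_eq_nil]

theorem forall_mem {l : α → List β} {P : α → β → Prop}
    (hl : PolyTime e (fun a => encList eb (l a)))
    (hP : PolyTime (fun p : α × β => .cons (e p.1) (eb p.2)) (fun p => truth (P p.1 p.2))) :
    PolyTime e (fun a => truth (∀ b ∈ l a, P a b)) :=
  (exists_mem (P := fun a b => ¬ P a b) hl hP.not).not.congr fun a => by simp

theorem mem {l : α → List β} {b : α → β} (heb : Function.Injective eb)
    (hb : PolyTime e (fun a => eb (b a))) (hl : PolyTime e (fun a => encList eb (l a))) :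
    PolyTime e (fun a => truth (b a ∈ l a)) := by
  refine (exists_mem (P := fun a b' => b' = b a) hl (Tractable.congr (id.snd.eq
    (hb.comp (f := Prod.fst) id.fst fun _ => le_rfl)) fun p => ?_)).congr fun a => ?_
  · simp [Data.snd, heb.eq_iff]
  · simp

/-- Inputs may be replaced by others with the same presentation. -/
theorem of_cover {g : α → Data} {e' g' : β → Data} (hg : PolyTime e' g')
    (hcover : ∀ a, ∃ b, e' b = e a ∧ g' b = g a) : PolyTime e g := by
  choose f hf hf' using hcover
  exact (hg.comp (f := f) (id.congr fun a => (hf a).symm) fun _ => le_rfl).congr hf'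

/-- A fixed number of components. -/
theorem ofFn {κ : α → ℕ} {k : ℕ} {g : α → Fin k → Data}
    (hg : ∀ i, Tractable κ e (fun a => g a i)) :
    Tractable κ e (fun a => Data.ofList (List.ofFn (g a))) := by
  induction k with
  | zero => exact nil.congr fun a => by simp [Data.ofList]
  | succ k ih =>
    exact ((hg 0).pair (ih (g := fun a i => g a i.succ) fun i => hg i.succ)).congr fun a => by
      simp [List.ofFn_succ, Data.ofList]

end Tractable

end CQA

namespace CQA

/-! ### Injectivity of the encodings, and polynomial time for the database operations. -/

section Programs

variable {S : Schema} {U : Type*} {code : U → Data}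

theorem Data.ofNat_injective : Function.Injective Data.ofNat := by
  intro m
  induction m with
  | zero => intro n h; cases n <;> simp_all [Data.ofNat]
  | succ m ih =>
    intro n h
    cases n with
    | zero => simp [Data.ofNat] at h
    | succ n => simp only [Data.ofNat, Data.cons.injEq, true_and] at h; rw [ih h]

theorem Data.ofList_injective : Function.Injective Data.ofList := by
  intro l
  induction l with
  | nil => intro l' h; cases l' <;> simp_all [Data.ofList]
  | cons a l ih =>
    intro l' h
    cases l' with
    | nil => simp [Data.ofList] at h
    | cons a' l' => simp only [Data.ofList, Data.cons.injEq] at h; rw [h.1, ih h.2]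

theorem encFact_injective (hcode : Function.Injective code) :
    Function.Injective (encFact (S := S) code) := by
  rintro ⟨R, t⟩ ⟨R', t'⟩ h
  simp only [encFact, encTuple, Data.cons.injEq] at h
  obtain rfl : R = R' := Fin.ext (Data.ofNat_injective h.1)
  have := List.ofFn_injective (Data.ofList_injective h.2)
  congr 1
  funext i
  exact hcode (congrFun this i)

theorem encTuple_succ {k : ℕ} (t : Fin (k + 1) → U) :
    encTuple code t = .cons (code (t 0)) (encTuple code fun i => t i.succ) := by
  simp [encTuple, List.ofFn_succ, Data.ofList]

theorem encList_ofFn {k : ℕ} (t : Fin k → U) : encList code (List.ofFn t) = encTuple code t := by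
  rw [encList, encTuple, List.map_ofFn]; rfl

theorem encTuple_update {k : ℕ} (t : Fin k → U) (i : Fin k) (a : U) :
    encTuple code (Function.update t i a) =
      .ofList ((List.ofFn fun i => code (t i)).set i (code a)) := by
  rw [encTuple]
  congr 1
  refine List.ext_getElem (by simp) fun j h1 h2 => ?_
  simp only [List.length_ofFn] at h1
  simp only [List.getElem_ofFn, List.getElem_set]
  by_cases h : (i : ℕ) = j
  · subst h; simp
  · have : (⟨j, h1⟩ : Fin k) ≠ i := fun hj => h (by rw [← hj])
    simp [h, Function.update_of_ne this]

/-- Case distinction on the kind of an update. -/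
theorem PolyTime.update_cases {β : Type*} {eb : β → Data} {g : Update S U → β → Data}
    (h₁ : PolyTime (fun p : Fact S U × β => .cons (encUpdate code (.insert p.1)) (eb p.2))
      (fun p => g (.insert p.1) p.2))
    (h₂ : PolyTime (fun p : Fact S U × β => .cons (encUpdate code (.delete p.1)) (eb p.2))
      (fun p => g (.delete p.1) p.2))
    (h₃ : PolyTime (fun p : (Σ t : Fact S U, Fin (S.arity t.1)) × U × β =>
        .cons (encUpdate code (.change p.1.1 p.1.2 p.2.1)) (eb p.2.2))
      (fun p => g (.change p.1.1 p.1.2 p.2.1) p.2.2)) :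
    PolyTime (fun p : Update S U × β => .cons (encUpdate code p.1) (eb p.2))
      (fun p => g p.1 p.2) := by
  -- The tags 0, 1, 2 are unary: a non-`nil` tag excludes insertion, and then a non-`nil` tail of
  -- the tag singles out a change.
  refine .ite Tractable.id.fst.fst
    (.ite Tractable.id.fst.fst.snd (h₃.of_cover ?_) (h₂.of_cover ?_)) (h₁.of_cover ?_)
  · rintro ⟨⟨⟨u, b⟩, hu⟩, hu'⟩
    cases u with
    | insert t => simp [encUpdate, Data.ofNat, Data.fst] at hu
    | delete t => simp [encUpdate, Data.ofNat, Data.fst, Data.snd] at hu'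
    | change t A a => exact ⟨(⟨t, A⟩, a, b), rfl, rfl⟩
  · rintro ⟨⟨⟨u, b⟩, hu⟩, hu'⟩
    cases u with
    | insert t => simp [encUpdate, Data.ofNat, Data.fst] at hu
    | delete t => exact ⟨(t, b), rfl, rfl⟩
    | change t A a => simp [encUpdate, Data.ofNat, Data.fst, Data.snd] at hu'
  · rintro ⟨⟨u, b⟩, hu⟩
    cases u with
    | insert t => exact ⟨(t, b), rfl, rfl⟩
    | delete t => simp [encUpdate, Data.ofNat, Data.fst] at hu
    | change t A a => simp [encUpdate, Data.ofNat, Data.fst] at hu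

/-! ### Atoms, comparisons, queries -/

namespace Tractable

variable {α : Type*} {κ : α → ℕ} {e : α → Data}

/-- The position is fixed in advance, so a fixed chain of projections does the work. -/
theorem tuple_apply {k : ℕ} {v : α → Fin k → U} (hv : Tractable κ e (fun a => encTuple code (v a)))
    (i : Fin k) : Tractable κ e (fun a => code (v a i)) := by
  induction k with
  | zero => exact i.elim0
  | succ k ih =>
    simp only [encTuple_succ] at hv
    cases i using Fin.cases with
    | zero => exact hv.fst
    | succ i => exact ih (v := fun a i => v a i.succ) hv.snd i

theorem termEval {n : ℕ} {v : α → Fin n → U} (hv : Tractable κ e (fun a => encTuple code (v a)))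
    (s : Term U n) : Tractable κ e (fun a => code (s.eval (v a))) := by
  cases s with
  | var i => exact tuple_apply hv i
  | const a => exact const (code a)

theorem ground {n : ℕ} {v : α → Fin n → U} (hv : Tractable κ e (fun a => encTuple code (v a)))
    (A : Atom S U n) : Tractable κ e (fun a => encFact code (A.ground (v a))) :=
  (const (Data.ofNat A.rel)).pair
    (ofFn (g := fun a i => code ((A.args i).eval (v a))) fun i => termEval hv (A.args i))

variable [LinearOrder U]

theorem le (hle : InPTIME (encPair code) {x : U × U | x.1 ≤ x.2}) {x y : α → U}
    (hx : Tractable κ e (fun a => code (x a))) (hy : Tractable κ e (fun a => code (y a))) :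
    Tractable κ e (fun a => truth (x a ≤ y a)) := by
  obtain ⟨p, K, c, hp⟩ := hle
  choose g t hr ht hg using hp
  have : PolyTime (encPair code) g :=
    ⟨p, _, ⟨K, 1, c, fun a => le_rfl⟩, fun a => ⟨t a, by simpa using ht a, hr a⟩⟩
  exact (this.truth_of_iff hg).comp (f := fun a => (x a, y a)) (hx.pair hy) fun _ => Nat.zero_le _

/-- By linearity and antisymmetry, all six predicates are Boolean combinations of `≤` in the two
directions. -/
theorem comparison (hle : InPTIME (encPair code) {x : U × U | x.1 ≤ x.2}) {n : ℕ}
    {v : α → Fin n → U} (hv : Tractable κ e (fun a => encTuple code (v a)))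
    (γ : Comparison U n) : Tractable κ e (fun a => truth (γ.Holds (v a))) := by
  obtain ⟨op, s, s'⟩ := γ
  have h := le hle (termEval hv s) (termEval hv s')
  have h' := le hle (termEval hv s') (termEval hv s)
  cases op <;> simp only [Comparison.Holds, CmpOp.Holds]
  · exact (h.and h').congr fun a => by rw [le_antisymm_iff (α := U)]
  · exact (h.and h').not.congr fun a => by rw [ne_eq, le_antisymm_iff (α := U)]
  · exact h'.not.congr fun a => by rw [not_le]
  · exact h
  · exact h.not.congr fun a => by rw [not_le]
  · exact h'

theorem query (hcode : Function.Injective code)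
    (hle : InPTIME (encPair code) {x : U × U | x.1 ≤ x.2}) {n : ℕ} (Q : Query S U n)
    {l : α → List (Fact S U)} {v : α → Fin n → U}
    (hl : PolyTime e (fun a => encList (encFact code) (l a)))
    (hv : PolyTime e (fun a => encTuple code (v a))) :
    PolyTime e (fun a => truth (Q.Holds (l a).toFinset (v a))) := by
  refine all Q fun L _ => ?_
  cases L with
  | pos A =>
    simpa only [Literal.Holds, List.mem_toFinset] using
      mem (encFact_injective hcode) (ground hv A) hl
  | neg A =>
    simpa only [Literal.Holds, List.mem_toFinset] using
      (mem (encFact_injective hcode) (ground hv A) hl).not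
  | cmp γ => exact comparison hle hv γ

end Tractable

/-! ### Conflicts -/

/-- The constants of a list of facts. -/
def activeDomain (l : List (Fact S U)) : List U := l.flatMap fun t => List.ofFn t.2

/-- All tuples of constants from a list. -/
def tuples (l : List U) : (n : ℕ) → List (Fin n → U)
  | 0 => [Fin.elim0]
  | n + 1 => l.flatMap fun a => (tuples l n).map fun v => Fin.cons a v

theorem mem_tuples {l : List U} {n : ℕ} {v : Fin n → U} : v ∈ tuples l n ↔ ∀ i, v i ∈ l := by
  induction n with
  | zero => simp [tuples, Subsingleton.elim v Fin.elim0]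
  | succ n ih =>
    simp only [tuples, List.mem_flatMap, List.mem_map, ih, Fin.forall_fin_succ]
    constructor
    · rintro ⟨a, ha, w, hw, rfl⟩
      simpa using ⟨ha, hw⟩
    · rintro ⟨h0, h⟩
      exact ⟨v 0, h0, Fin.tail v, h, Fin.cons_self_tail v⟩

theorem polyTime_activeDomain :
    PolyTime (encList (encFact (S := S) code)) (fun l => encList code (activeDomain l)) :=
  .flatMap (eb := encFact code) (l := fun l => l) .id (Tractable.id.snd.snd.congr fun p => by
    simp only [encFact, Data.snd, encList_ofFn])

/-- The exponent `n` of the number of tuples is fixed. It will be the number of variables of a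
constraint, so exhaustive search over assignments is polynomial. -/
theorem polyTime_tuples (n : ℕ) :
    PolyTime (encList code) (fun l => encList (encTuple code) (tuples l n)) := by
  induction n with
  | zero => exact Tractable.const _
  | succ n ih =>
    refine .flatMap (l := fun l => l) (eb := code) .id ?_
    refine .map (eb := encTuple code) (ih.comp (f := Prod.fst) Tractable.id.fst fun _ => le_rfl) ?_
    refine (Tractable.id.fst.snd.pair Tractable.id.snd).congr fun p => ?_
    simp [encTuple_succ, Data.fst, Data.snd]

variable [LinearOrder U]

/-- The assignment `v` violates the denial constraint in a list of facts. -/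
def DenialConstraint.ViolatedBy (φ : DenialConstraint S U) (l : List (Fact S U))
    (v : Fin φ.numVars → U) : Prop :=
  (∀ A ∈ φ.atoms, A.ground v ∈ l) ∧ ∀ γ ∈ φ.comparisons, γ.Holds v

open scoped Classical in
/-- The sets of facts that together violate one of the constraints. -/
noncomputable def conflicts (IC : List (DenialConstraint S U)) (l : List (Fact S U)) :
    List (List (Fact S U)) :=
  IC.flatMap fun φ => ((tuples (activeDomain l) φ.numVars).filter fun v => φ.ViolatedBy l v).map
    fun v => φ.atoms.map fun A => A.ground v

/-- The lists that arise by deleting one fact of the first conflict. -/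
noncomputable def children (IC : List (DenialConstraint S U)) (l : List (Fact S U)) :
    List (List (Fact S U)) :=
  ((conflicts IC l).headD []).map fun t => l.filter fun s => s ≠ t

theorem polyTime_violatedBy (hcode : Function.Injective code)
    (hle : InPTIME (encPair code) {x : U × U | x.1 ≤ x.2}) (φ : DenialConstraint S U) :
    PolyTime (fun p : List (Fact S U) × (Fin φ.numVars → U) =>
      .cons (encList (encFact code) p.1) (encTuple code p.2))
      (fun p => truth (φ.ViolatedBy p.1 p.2)) :=
  .and (.all φ.atoms fun A _ => .mem (encFact_injective hcode) (.ground Tractable.id.snd A)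
      Tractable.id.fst)
    (.all φ.comparisons fun γ _ => .comparison hle Tractable.id.snd γ)

theorem polyTime_conflicts (hcode : Function.Injective code)
    (hle : InPTIME (encPair code) {x : U × U | x.1 ≤ x.2}) (IC : List (DenialConstraint S U)) :
    PolyTime (encList (encFact code))
      (fun l => encList (encList (encFact code)) (conflicts IC l)) := by
  classical
  induction IC with
  | nil => exact Tractable.nil
  | cons φ IC ih =>
    refine .append (l' := conflicts IC) (.map (eb := encTuple code) (.filter
      ((polyTime_tuples φ.numVars).comp (f := activeDomain) polyTime_activeDomain
        fun _ => le_rfl) (polyTime_violatedBy hcode hle φ)) ?_) ih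
    have : PolyTime (encTuple code)
        (fun v => encList (encFact code) (φ.atoms.map fun A => A.ground v)) := by
      induction φ.atoms with
      | nil => exact Tractable.nil
      | cons A As ih => exact (Tractable.ground Tractable.id A).pair ih
    exact this.comp (f := Prod.snd) Tractable.id.snd fun _ => le_rfl

theorem polyTime_filter_ne (hcode : Function.Injective code) {α : Type*} {e : α → Data}
    {l : α → List (Fact S U)} {t : α → Fact S U}
    (hl : PolyTime e (fun a => encList (encFact code) (l a)))
    (ht : PolyTime e (fun a => encFact code (t a))) :
    PolyTime e (fun a => encList (encFact code) ((l a).filter fun s => s ≠ t a)) := by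
  refine .filter hl (Tractable.not ((Tractable.id.snd.eq
    (ht.comp (f := Prod.fst) Tractable.id.fst fun _ => le_rfl)).congr fun p => ?_))
  simp [Data.snd, (encFact_injective hcode).eq_iff]

theorem polyTime_children (hcode : Function.Injective code)
    (hle : InPTIME (encPair code) {x : U × U | x.1 ≤ x.2}) (IC : List (DenialConstraint S U)) :
    PolyTime (encList (encFact code))
      (fun l => encList (encList (encFact code)) (children IC l)) := by
  refine .map (eb := encFact code) (l := fun l => (conflicts IC l).headD [])
    ((polyTime_conflicts hcode hle IC).fst.congr fun l => ?_)
    (polyTime_filter_ne hcode Tractable.id.fst Tractable.id.snd)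
  cases conflicts IC l <;> simp [Data.fst]

theorem polyTime_conflicts_eq_nil (hcode : Function.Injective code)
    (hle : InPTIME (encPair code) {x : U × U | x.1 ≤ x.2}) (IC : List (DenialConstraint S U)) :
    PolyTime (encList (encFact code)) (fun l => truth (conflicts IC l = [])) :=
  ((polyTime_conflicts hcode hle IC).truth_of_iff (P := fun l => conflicts IC l ≠ [])
    fun l => by simp [encList_eq_nil]).not.congr fun l => by simp

/-! ### Updates -/

/-- The tuple that an update may put into the database. -/
def Update.result : Update S U → Fact S U
  | .insert t => t
  | .delete t => t
  | .change t A a => ⟨t.1, Function.update t.2 A a⟩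

/-- The effect of an update on a list of facts. -/
def Update.applyList (l : List (Fact S U)) : Update S U → List (Fact S U)
  | .insert t => t :: l
  | .delete t => l.filter fun s => s ≠ t
  | .change t A a =>
      if t ∈ l then (Update.change t A a).result :: l.filter fun s => s ≠ t else l

theorem Update.toFinset_applyList (l : List (Fact S U)) (u : Update S U) :
    (u.applyList l).toFinset = u.apply l.toFinset := by
  ext s
  cases u with
  | insert t => simp [applyList, apply]
  | delete t => simp [applyList, apply, and_comm]
  | change t A a =>
    by_cases h : t ∈ l <;> simp [applyList, apply, h, result, and_comm]

theorem toFinset_foldl_applyList (l : List (Fact S U)) (us : List (Update S U)) :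
    (us.foldl Update.applyList l).toFinset = applyUpdates l.toFinset us := by
  induction us generalizing l with
  | nil => rfl
  | cons u us ih => simp only [List.foldl_cons, ih, Update.toFinset_applyList, applyUpdates]

/-- Replace a component of a list, given its position in unary; only the first components, as many
as the first argument says, are taken into account. -/
def Data.setNth : ℕ → Data → Data → Data → Data
  | 0, d, _, _ => d
  | k + 1, d, i, a => if i = nil then cons a d.snd else cons d.fst (setNth k d.snd i.snd a)

theorem Data.setNth_ofList {k i : ℕ} {l : List Data} (a : Data) (hi : i < l.length) (hk : i < k) :
    setNth k (ofList l) (ofNat i) a = ofList (l.set i a) := by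
  induction k generalizing i l with
  | zero => omega
  | succ k ih =>
    cases l with
    | nil => simp at hi
    | cons b l =>
      cases i with
      | zero => simp [setNth, ofNat, ofList, snd]
      | succ i =>
        simp only [List.length_cons, Nat.add_lt_add_iff_right] at hi hk
        simp [setNth, ofNat, ofList, fst, snd, ih hi hk]

theorem polyTime_setNth (k : ℕ) :
    PolyTime (fun p : Data × Data × Data => .cons p.1 (.cons p.2.1 p.2.2))
      (fun p => Data.setNth k p.1 p.2.1 p.2.2) := by
  induction k with
  | zero => exact Tractable.id.fst
  | succ k ih =>
    refine .ite (c := fun p => p.2.1) Tractable.id.snd.fst ?_ ?_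
    · refine (Tractable.id.fst.fst.pair (ih.comp
        (f := fun p : {p : Data × Data × Data // p.2.1 ≠ .nil} =>
          (p.1.1.snd, p.1.2.1.snd, p.1.2.2))
        (Tractable.id.fst.snd.pair (Tractable.id.snd.fst.snd.pair Tractable.id.snd.snd))
        fun _ => le_rfl)).congr fun p => ?_
      simp [Data.setNth, p.2, Data.fst]
    · refine (Tractable.id.snd.snd.pair Tractable.id.fst.snd).congr fun p => ?_
      simp [Data.setNth, p.2, Data.fst, Data.snd]

theorem Data.size_ofList_set_le (l : List Data) (i : ℕ) (a : Data) :
    (ofList (l.set i a)).size ≤ (ofList l).size + a.size := by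
  induction l generalizing i with
  | nil => simp
  | cons b l ih =>
    cases i with
    | zero => simp only [List.set_cons_zero, ofList, size]; omega
    | succ i => have := ih i; simp only [List.set_cons_succ, ofList, size]; omega

/-- The growth is additive, so a whole update sequence enlarges the database at most by its own
size; this is the prefix bound needed for the fold. -/
theorem Update.size_applyList_le (l : List (Fact S U)) (u : Update S U) :
    (encList (encFact code) (u.applyList l)).size ≤
      (encList (encFact code) l).size + (encUpdate code u).size := by
  have hf : ∀ t : Fact S U, (encList (encFact code) (l.filter fun s => s ≠ t)).size ≤
      (encList (encFact code) l).size := fun t => size_encList_le_of_sublist _ List.filter_sublist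
  cases u with
  | insert t => simp only [applyList, encList_cons, Data.size, encUpdate]; omega
  | delete t => exact (hf t).trans (Nat.le_add_right _ _)
  | change t A a =>
    simp only [applyList]
    split
    · have h1 := hf t
      have h2 := Data.size_ofList_set_le (List.ofFn fun i => code (t.2 i)) A (code a)
      simp only [result, encList_cons, Data.size, encUpdate, encFact, encTuple_update] at *
      simp only [encTuple]
      omega
    · exact Nat.le_add_right _ _

theorem size_foldl_applyList_le (l : List (Fact S U)) (us : List (Update S U)) :
    (encList (encFact code) (us.foldl Update.applyList l)).size ≤
      (encList (encFact code) l).size + (encList (encUpdate code) us).size := by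
  induction us generalizing l with
  | nil => simp
  | cons u us ih =>
    have h1 := ih (u.applyList l)
    have h2 := u.size_applyList_le (code := code) l
    simp only [List.foldl_cons, encList_cons, Data.size]
    omega

theorem polyTime_applyList (hcode : Function.Injective code) :
    PolyTime (fun p : Update S U × List (Fact S U) =>
      .cons (encUpdate code p.1) (encList (encFact code) p.2))
      (fun p => encList (encFact code) (p.1.applyList p.2)) := by
  -- The schema has finitely many relations, so a single bound `k` lets one `Data.setNth` program
  -- serve all arities.
  obtain ⟨k, hk⟩ : ∃ k, ∀ R, S.arity R ≤ k :=
    ⟨Finset.univ.sup S.arity, fun R => Finset.le_sup (Finset.mem_univ R)⟩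
  refine .update_cases (g := fun u l => encList (encFact code) (u.applyList l))
    (Tractable.id.fst.snd.pair Tractable.id.snd)
    (polyTime_filter_ne hcode Tractable.id.snd Tractable.id.fst.snd) ?_
  have ht : PolyTime (fun p : (Σ t : Fact S U, Fin (S.arity t.1)) × U × List (Fact S U) =>
      .cons (encUpdate code (.change p.1.1 p.1.2 p.2.1)) (encList (encFact code) p.2.2))
      (fun p => encFact code p.1.1) := Tractable.id.fst.snd.fst
  refine .ite (Tractable.mem (encFact_injective hcode) ht Tractable.id.snd) ?_ ?_
  · have ht' := ht.reindex (Subtype.val : {p // truth (p.1.1 ∈ p.2.2) ≠ .nil} → _)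
    refine Tractable.congr (Tractable.pair (ht'.fst.pair
      ((polyTime_setNth k).comp (f := fun p : {p : (Σ t : Fact S U, Fin (S.arity t.1)) × U ×
          List (Fact S U) // truth (p.1.1 ∈ p.2.2) ≠ .nil} =>
          (encTuple code p.1.1.1.2, .ofNat p.1.1.2, code p.1.2.1))
        (ht'.snd.pair (Tractable.id.fst.snd.snd.fst.pair Tractable.id.fst.snd.snd.snd))
        fun _ => le_rfl)) (polyTime_filter_ne hcode Tractable.id.snd ht')) ?_
    rintro ⟨⟨⟨t, A⟩, a, l⟩, h⟩
    have h' : t ∈ l := by simpa using h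
    simp only [Update.applyList, h', if_true, encList_cons, encFact, Update.result,
      encTuple_update, Data.fst]
    rw [encTuple, Data.setNth_ofList _ (by simp) (A.2.trans_le (hk t.1))]
  · refine Tractable.id.snd.congr ?_
    rintro ⟨⟨⟨t, A⟩, a, l⟩, h⟩
    have h' : t ∉ l := by simpa using h
    simp [Update.applyList, h', Data.snd]

theorem polyTime_foldl_applyList (hcode : Function.Injective code) {n : ℕ} :
    PolyTime (encInput (S := S) (n := n) code)
      (fun x => encList (encFact code) (x.updates.foldl Update.applyList x.db)) := by
  have hdb : PolyTime (encInput (S := S) (n := n) code)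
      (fun x => encList (encFact code) x.db) := Tractable.id.fst
  have hup : PolyTime (encInput (S := S) (n := n) code)
      (fun x => encList (encUpdate code) x.updates) := Tractable.id.snd.fst
  exact .foldl (step := fun _ u l => u.applyList l) hup hdb
    ((polyTime_applyList hcode).comp (f := Prod.snd) Tractable.id.snd fun _ => le_rfl)
    (hdb.size_bound.add hup.size_bound) fun x us h =>
      (size_foldl_applyList_le x.db us).trans
        (Nat.add_le_add_left (size_encList_le_of_sublist _ h.sublist) _)

end Programs

end CQA

namespace CQA

/-! ### Conflicts, the search tree, and its relation to C-repairs. -/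

section Repairs

variable {S : Schema} {U : Type*} [LinearOrder U]

theorem DenialConstraint.holds_toFinset_iff {φ : DenialConstraint S U} {l : List (Fact S U)} :
    φ.Holds l.toFinset ↔ ∀ v, ¬ φ.ViolatedBy l v := by
  simp only [Holds, ViolatedBy, List.mem_toFinset]

/-- By safety every variable occurs in an atom whose ground instance belongs to `l`. Hence
restricting `conflicts` to the active domain misses no violation. -/
theorem DenialConstraint.ViolatedBy.mem_tuples {φ : DenialConstraint S U} {l : List (Fact S U)}
    {v : Fin φ.numVars → U} (h : φ.ViolatedBy l v) : v ∈ tuples (activeDomain l) φ.numVars := by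
  refine CQA.mem_tuples.2 fun x => ?_
  obtain ⟨A, hA, i, hi⟩ := φ.safe x
  refine List.mem_flatMap.2 ⟨A.ground v, h.1 A hA, List.mem_ofFn.2 ⟨i, ?_⟩⟩
  change (A.args i).eval v = v x
  rw [hi]
  rfl

theorem mem_conflicts {IC : List (DenialConstraint S U)} {l w : List (Fact S U)} :
    w ∈ conflicts IC l ↔
      ∃ φ ∈ IC, ∃ v, φ.ViolatedBy l v ∧ φ.atoms.map (fun A => A.ground v) = w := by
  simp only [conflicts, List.mem_flatMap, List.mem_map, List.mem_filter, decide_eq_true_eq]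
  refine exists_congr fun φ => and_congr_right fun _ => exists_congr fun v =>
    and_congr_left fun _ => ?_
  exact ⟨fun h => h.2, fun h => ⟨h.mem_tuples, h⟩⟩

theorem conflicts_eq_nil {IC : List (DenialConstraint S U)} {l : List (Fact S U)} :
    conflicts IC l = [] ↔ ∀ φ ∈ IC, φ.Holds l.toFinset := by
  simp only [List.eq_nil_iff_forall_not_mem, mem_conflicts, DenialConstraint.holds_toFinset_iff]
  constructor
  · exact fun h φ hφ v hv => h _ ⟨φ, hφ, v, hv, rfl⟩
  · rintro h w ⟨φ, hφ, v, hv, -⟩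
    exact h φ hφ v hv

theorem subset_of_mem_conflicts {IC : List (DenialConstraint S U)} {l w : List (Fact S U)}
    (hw : w ∈ conflicts IC l) : w ⊆ l := by
  obtain ⟨φ, -, v, hv, rfl⟩ := mem_conflicts.1 hw
  intro t ht
  obtain ⟨A, hA, rfl⟩ := List.mem_map.1 ht
  exact hv.1 A hA

/-- The comparisons do not depend on the instance, so if `D` contained all of `w`, the same
assignment would violate the constraint in `D`. -/
theorem exists_notMem_of_mem_conflicts {IC : List (DenialConstraint S U)} {l w : List (Fact S U)}
    (hw : w ∈ conflicts IC l) {D : Instance S U} (hD : ∀ φ ∈ IC, φ.Holds D) :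
    ∃ t ∈ w, t ∉ D := by
  obtain ⟨φ, hφ, v, hv, rfl⟩ := mem_conflicts.1 hw
  by_contra! h
  exact hD φ hφ v ⟨fun A hA => h _ (List.mem_map.2 ⟨A, hA, rfl⟩), hv.2⟩

/-- The first conflict comes from one constraint and has one entry per atom. The sum over all
constraints is a crude bound, but it is independent of the database. -/
theorem length_children_le (IC : List (DenialConstraint S U)) (l : List (Fact S U)) :
    (children IC l).length ≤ (IC.map fun φ => φ.atoms.length).sum := by
  rw [children, List.length_map]
  cases h : conflicts IC l with
  | nil => simp
  | cons w ws =>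
    obtain ⟨φ, hφ, v, -, hw⟩ := mem_conflicts.1 (h ▸ List.mem_cons_self .. : w ∈ conflicts IC l)
    rw [List.headD_cons, ← hw, List.length_map]
    exact List.single_le_sum (by simp) _ (List.mem_map.2 ⟨φ, hφ, rfl⟩)

/-- The levels of the search tree that branches on the fact to be deleted from a conflict. -/
noncomputable def level (IC : List (DenialConstraint S U)) (l : List (Fact S U)) :
    ℕ → List (List (Fact S U))
  | 0 => [l]
  | i + 1 => (level IC l i).flatMap (children IC)

variable {IC : List (DenialConstraint S U)} {l : List (Fact S U)}

theorem exists_mem_of_mem_children {s : List (Fact S U)} (h : s ∈ children IC l) :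
    ∃ t ∈ l, s = l.filter fun r => r ≠ t := by
  rw [children] at h
  cases hc : conflicts IC l with
  | nil => simp [hc] at h
  | cons w ws =>
    rw [hc, List.headD_cons, List.mem_map] at h
    obtain ⟨t, ht, rfl⟩ := h
    exact ⟨t, subset_of_mem_conflicts (hc ▸ List.mem_cons_self .. : w ∈ conflicts IC l) ht, rfl⟩

theorem length_level_le (i : ℕ) :
    (level IC l i).length ≤ (IC.map fun φ => φ.atoms.length).sum ^ i := by
  induction i with
  | zero => simp [level]
  | succ i ih =>
    rw [level, List.length_flatMap]
    refine (List.sum_le_card_nsmul _ (IC.map fun φ => φ.atoms.length).sum ?_).trans ?_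
    · simp only [List.mem_map]
      rintro _ ⟨s, -, rfl⟩
      exact length_children_le IC s
    · rw [List.length_map, smul_eq_mul, pow_succ]
      exact Nat.mul_le_mul_right _ ih

/-- A conflict consists of facts still present, so every step deletes a new fact. Filtering removes
all its repetitions, so the count is exact for the underlying sets. -/
theorem sublist_and_card_of_mem_level {i : ℕ} {s : List (Fact S U)} (h : s ∈ level IC l i) :
    s.Sublist l ∧ (l.toFinset \ s.toFinset).card = i := by
  induction i generalizing s with
  | zero => obtain rfl : s = l := by simpa [level] using h
            simp
  | succ i ih =>
    obtain ⟨r, hr, hs⟩ := List.mem_flatMap.1 h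
    obtain ⟨t, ht, rfl⟩ := exists_mem_of_mem_children hs
    obtain ⟨h1, h2⟩ := ih hr
    refine ⟨List.filter_sublist.trans h1, ?_⟩
    have : l.toFinset \ (r.filter fun x => x ≠ t).toFinset =
        insert t (l.toFinset \ r.toFinset) := by
      ext x
      simp only [ne_eq, decide_not, Finset.mem_sdiff, List.mem_toFinset, List.mem_filter,
        Bool.not_eq_eq_eq_not, Bool.not_true, decide_eq_false_iff_not, not_and, not_not,
        Finset.mem_insert]
      by_cases hx : x = t
      · subst hx; simp [h1.subset ht]
      · simp [hx]
    rw [this, Finset.card_insert_of_notMem (by simp [ht]), h2]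

/-- Let `D` guide the descent: each node met is inconsistent, its first conflict contains a fact
outside `D`, and deleting that fact loses nothing of `D`. -/
theorem exists_mem_level_superset {D : Instance S U} (hD : ∀ φ ∈ IC, φ.Holds D) {i : ℕ}
    (h : ∀ j < i, ∀ s ∈ level IC l j, conflicts IC s ≠ []) :
    ∃ s ∈ level IC l i, l.toFinset ∩ D ⊆ s.toFinset := by
  induction i with
  | zero => exact ⟨l, by simp [level], Finset.inter_subset_left⟩
  | succ i ih =>
    obtain ⟨s, hs, hsub⟩ := ih fun j hj => h j (hj.trans i.lt_succ_self)
    cases hc : conflicts IC s with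
    | nil => exact absurd hc (h i i.lt_succ_self s hs)
    | cons w ws =>
      obtain ⟨t, ht, htD⟩ := exists_notMem_of_mem_conflicts
        (hc ▸ List.mem_cons_self .. : w ∈ conflicts IC s) hD
      refine ⟨s.filter fun r => r ≠ t, List.mem_flatMap.2 ⟨s, hs, ?_⟩, fun x hx => ?_⟩
      · rw [children, hc, List.headD_cons]
        exact List.mem_map.2 ⟨t, ht, rfl⟩
      · have hxs := List.mem_toFinset.1 (hsub hx)
        have : x ≠ t := fun hxt => htD (hxt ▸ (Finset.mem_inter.1 hx).2)
        simp [hxs, this]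

/-- The node reached under the guidance of `D` has lost exactly `i` facts, all of them outside `D`.
-/
theorem le_card_sdiff {D : Instance S U} (hD : ∀ φ ∈ IC, φ.Holds D) {i : ℕ}
    (h : ∀ j < i, ∀ s ∈ level IC l j, conflicts IC s ≠ []) : i ≤ (l.toFinset \ D).card := by
  obtain ⟨s, hs, hsub⟩ := exists_mem_level_superset hD h
  rw [← (sublist_and_card_of_mem_level hs).2]
  refine Finset.card_le_card fun x hx => ?_
  rw [Finset.mem_sdiff] at hx ⊢
  exact ⟨hx.1, fun hxD => hx.2 (hsub (Finset.mem_inter.2 ⟨hx.1, hxD⟩))⟩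

theorem exists_first_level {D : Instance S U} (hD : ∀ φ ∈ IC, φ.Holds D) :
    ∃ k ≤ (l.toFinset \ D).card, (∃ s ∈ level IC l k, conflicts IC s = []) ∧
      ∀ j < k, ∀ s ∈ level IC l j, conflicts IC s ≠ [] := by
  classical
  have hex : ∃ k, ∃ s ∈ level IC l k, conflicts IC s = [] := by
    by_contra! h
    -- If no level had a consistent node, the lower bound would hold for every `i`, in particular
    -- for one more than the cardinality itself.
    exact absurd (le_card_sdiff (i := (l.toFinset \ D).card + 1) hD fun j _ => h j) (by omega)
  have hmin : ∀ j < Nat.find hex, ∀ s ∈ level IC l j, conflicts IC s ≠ [] :=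
    fun j hj s hs hn => Nat.find_min hex hj ⟨s, hs, hn⟩
  exact ⟨_, le_card_sdiff hD hmin, Nat.find_spec hex, hmin⟩

theorem card_symmDiff_of_subset {D D' : Instance S U} (h : D' ⊆ D) :
    (symmDiff D' D).card = (D \ D').card := by
  rw [symmDiff_of_le h]

theorem card_sdiff_le_card_symmDiff (D D' : Instance S U) :
    (D \ D').card ≤ (symmDiff D' D).card :=
  Finset.card_le_card (by rw [symmDiff_def]; exact Finset.subset_union_right)

/-- The C-repairs are the consistent nodes of the first level that has any. -/
theorem isCRepair_iff_mem_level {k : ℕ} (hk : ∃ s ∈ level IC l k, conflicts IC s = [])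
    (hmin : ∀ j < k, ∀ s ∈ level IC l j, conflicts IC s ≠ []) {D : Instance S U} :
    IsCRepair (fun D => ∀ φ ∈ IC, φ.Holds D) l.toFinset D ↔
      ∃ s ∈ level IC l k, conflicts IC s = [] ∧ s.toFinset = D := by
  have hcard : ∀ s ∈ level IC l k, (symmDiff s.toFinset l.toFinset).card = k := by
    intro s hs
    obtain ⟨h1, h2⟩ := sublist_and_card_of_mem_level hs
    rw [card_symmDiff_of_subset, h2]
    exact fun x hx => List.mem_toFinset.2 (h1.subset (List.mem_toFinset.1 hx))
  constructor
  · rintro ⟨hD, hle⟩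
    obtain ⟨s₀, hs₀, hc₀⟩ := hk
    have h1 : (symmDiff D l.toFinset).card ≤ k := by
      by_contra! h
      have := hcard s₀ hs₀
      exact hle ⟨s₀.toFinset, conflicts_eq_nil.1 hc₀, by unfold leC; omega, by unfold leC; omega⟩
    -- The deletions alone already number at least `k`, while the whole symmetric difference has at
    -- most `k` elements. So a C-repair inserts nothing.
    have h2 := le_card_sdiff hD hmin
    have h3 : l.toFinset \ D = symmDiff D l.toFinset :=
      Finset.eq_of_subset_of_card_le (by rw [symmDiff_def]; exact Finset.subset_union_right)
        (h1.trans h2)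
    have h4 : D ⊆ l.toFinset := by
      intro x hx
      by_contra hxl
      have : x ∈ symmDiff D l.toFinset := Finset.mem_symmDiff.2 (Or.inl ⟨hx, hxl⟩)
      rw [← h3, Finset.mem_sdiff] at this
      exact this.2 hx
    -- The node found by following `D` contains `D`; since it has lost exactly `k` facts and `D` at
    -- most `k`, the two coincide.
    obtain ⟨s, hs, hsub⟩ := exists_mem_level_superset hD hmin
    rw [Finset.inter_eq_right.2 h4] at hsub
    obtain ⟨h5, h6⟩ := sublist_and_card_of_mem_level hs
    have h7 : s.toFinset ⊆ l.toFinset :=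
      fun x hx => List.mem_toFinset.2 (h5.subset (List.mem_toFinset.1 hx))
    have h8 : D = s.toFinset := by
      refine Finset.eq_of_subset_of_card_le hsub ?_
      have h9 := Finset.card_sdiff_add_card_eq_card h7
      have h10 := Finset.card_sdiff_add_card_eq_card h4
      rw [← h3] at h1
      omega
    exact ⟨s, hs, conflicts_eq_nil.2 (h8 ▸ hD), h8.symm⟩
  · rintro ⟨s, hs, hc, rfl⟩
    refine ⟨conflicts_eq_nil.1 hc, ?_⟩
    rintro ⟨D, hD, -, hlt⟩
    refine hlt ?_
    unfold leC
    rw [hcard s hs]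
    exact (le_card_sdiff hD hmin).trans (card_sdiff_le_card_symmDiff _ _)

/-- Only added facts count in this one-sided difference: a deletion costs nothing, and a change
costs at most one although it alters two facts. -/
theorem card_apply_sdiff_le (D D₀ : Instance S U) (u : Update S U) :
    (u.apply D \ D₀).card ≤ (D \ D₀).card + 1 := by
  suffices h : ∃ t, u.apply D ⊆ insert t D by
    obtain ⟨t, ht⟩ := h
    refine le_trans (Finset.card_le_card (t := insert t (D \ D₀)) fun x hx => ?_)
      (Finset.card_insert_le _ _)
    rw [Finset.mem_sdiff] at hx
    have := ht hx.1
    simp only [Finset.mem_insert, Finset.mem_sdiff] at this ⊢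
    tauto
  refine ⟨u.result, ?_⟩
  cases u with
  | insert t => exact subset_rfl
  | delete t => exact (Finset.erase_subset _ _).trans (Finset.subset_insert _ _)
  | change t A a =>
    simp only [Update.apply]
    split
    · exact Finset.insert_subset_insert _ (Finset.erase_subset _ _)
    · exact Finset.subset_insert _ _

theorem card_applyUpdates_sdiff_le (D D₀ : Instance S U) (us : List (Update S U)) :
    (applyUpdates D us \ D₀).card ≤ (D \ D₀).card + us.length := by
  induction us generalizing D with
  | nil => simp [applyUpdates]
  | cons u us ih =>
    have h1 := ih (u.apply D)
    have h2 := card_apply_sdiff_le D D₀ u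
    simp only [applyUpdates, List.foldl_cons, List.length_cons] at *
    omega

/-! ### Functional dependencies as denial constraints -/

/-- The denial constraint that no two tuples agree on the left-hand side of a functional dependency
and differ on a given attribute. -/
noncomputable def FunctionalDependency.toDenial (φ : FunctionalDependency S) (j : Fin (S.arity φ.rel)) :
    DenialConstraint S U where
  numVars := S.arity φ.rel + S.arity φ.rel
  atoms := [⟨φ.rel, fun i => .var (Fin.castAdd _ i)⟩, ⟨φ.rel, fun i => .var (Fin.natAdd _ i)⟩]
  comparisons := ⟨.ne, .var (Fin.castAdd _ j), .var (Fin.natAdd _ j)⟩ ::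
    φ.lhs.toList.map fun i => ⟨.eq, .var (Fin.castAdd _ i), .var (Fin.natAdd _ i)⟩
  safe x := by
    cases x using Fin.addCases with
    | left i => exact ⟨_, List.mem_cons_self .., i, rfl⟩
    | right i => exact ⟨_, List.mem_cons_of_mem _ (List.mem_cons_self ..), i, rfl⟩

/-- Disagreement on the right-hand side is a disjunction over its attributes, whereas a denial
constraint admits only conjunctions; hence one constraint per attribute. -/
theorem FunctionalDependency.holds_iff_forall_toDenial {φ : FunctionalDependency S}
    {D : Instance S U} : φ.Holds D ↔ ∀ j ∈ φ.rhs, (φ.toDenial (U := U) j).Holds D := by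
  constructor
  · rintro h j hj v ⟨hA, hC⟩
    have hs : ⟨φ.rel, fun i => v (Fin.castAdd _ i)⟩ ∈ D := hA _ (List.mem_cons_self ..)
    have ht : ⟨φ.rel, fun i => v (Fin.natAdd _ i)⟩ ∈ D :=
      hA _ (List.mem_cons_of_mem _ (List.mem_cons_self ..))
    have hne : v (Fin.castAdd _ j) ≠ v (Fin.natAdd _ j) := hC _ (List.mem_cons_self ..)
    exact hne (h _ _ hs ht (fun i hi => hC _ (List.mem_cons_of_mem _
      (List.mem_map.2 ⟨i, Finset.mem_toList.2 hi, rfl⟩))) j hj)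
  · intro h s t hs ht hst j hj
    by_contra hne
    refine h j hj (Fin.append s t) ⟨fun A hA => ?_, fun γ hγ => ?_⟩
    · rcases List.mem_cons.1 hA with rfl | hA
      · simpa [Atom.ground, Term.eval] using hs
      · obtain rfl := List.mem_singleton.1 hA
        change (⟨φ.rel, fun i => Fin.append s t (Fin.natAdd _ i)⟩ : Fact S U) ∈ D
        simpa only [Fin.append_right] using ht
    · rcases List.mem_cons.1 hγ with rfl | hγ
      · change Fin.append s t (Fin.castAdd _ j) ≠ Fin.append s t (Fin.natAdd _ j)
        simpa only [Fin.append_right, Fin.append_left] using hne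
      · obtain ⟨i, hi, rfl⟩ := List.mem_map.1 hγ
        change Fin.append s t (Fin.castAdd _ i) = Fin.append s t (Fin.natAdd _ i)
        simpa only [Fin.append_right, Fin.append_left] using hst i (Finset.mem_toList.1 hi)

end Repairs

end CQA

namespace CQA

/-! ### Assembling the fixed-parameter algorithm. -/

theorem computable_mul_pow (A B : ℕ) : Computable (fun m : ℕ => A * B ^ m) := by
  have h : Primrec (fun m : ℕ => Nat.rec (motive := fun _ => ℕ) A (fun _ r => B * r) m) :=
    Primrec.nat_rec₁ A (Primrec.nat_mul.comp₂ (Primrec₂.const B) Primrec₂.right)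
  refine (h.of_eq fun m => ?_).to_comp
  induction m with
  | zero => simp
  | succ m ih =>
    change B * Nat.rec (motive := fun _ => ℕ) A (fun _ r => B * r) m = _
    rw [ih]
    ring

theorem Tractable.inFPT {α : Type*} {κ : α → ℕ} {e : α → Data} {L : Set α}
    (h : Tractable κ e (fun a => truth (a ∈ L))) : InFPT e κ L := by
  obtain ⟨p, T, ⟨A, B, c, hT⟩, hp⟩ := h
  refine ⟨p, fun m => A * B ^ m, c, computable_mul_pow A B, fun a => ?_⟩
  obtain ⟨t, ht, hr⟩ := hp a
  exact ⟨_, t, hr, ht.trans (hT a), by simp⟩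

variable {S : Schema} {U : Type*} [LinearOrder U] {code : U → Data}

/-- The algorithm rejects an inconsistent `D`, applies the updates, expands the search tree level by
level until a consistent node appears, and tests `Q` at all consistent nodes of that level. -/
theorem tractable_incrementalCQA (hcode : Function.Injective code)
    (hle : InPTIME (encPair code) {x : U × U | x.1 ≤ x.2}) {n : ℕ} (Q : Query S U n)
    (IC : List (DenialConstraint S U)) :
    Tractable numUpdates (encInput code)
      (fun x => truth (x ∈ incrementalCQA (fun D => ∀ φ ∈ IC, φ.Holds D) Q)) := by
  have hcons := polyTime_conflicts_eq_nil hcode hle IC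
  -- Testing `D` first restricts the search to inputs with consistent `D`, where termination within
  -- `m` rounds is guaranteed.
  refine .ite ((hcons.comp (e := encInput code) (f := Input.db) Tractable.id.fst
    fun _ => le_rfl).of_polyTime) ?_ (Tractable.nil.congr fun x => ?_)
  swap
  · refine (truth_of_not fun hx => truth_eq_nil.1 x.2 ?_).symm
    exact conflicts_eq_nil.2 hx.1
  let d := (IC.map fun φ => φ.atoms.length).sum
  let l : {x : Input S U n // truth (conflicts IC x.db = []) ≠ .nil} → List (Fact S U) :=
    fun x => x.1.updates.foldl Update.applyList x.1.db
  have hD : ∀ x : {x : Input S U n // truth (conflicts IC x.db = []) ≠ .nil},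
      ∀ φ ∈ IC, φ.Holds x.1.db.toFinset := fun x =>
    conflicts_eq_nil.1 (by simpa using x.2)
  -- The depth `k` is used only in the analysis; the program finds it through its loop test.
  choose k hk hex hmin using fun x => exists_first_level (l := l x) (hD x)
  have hkm : ∀ x, k x ≤ numUpdates x.1 := fun x => by
    refine (hk x).trans ?_
    have h := card_applyUpdates_sdiff_le x.1.db.toFinset x.1.db.toFinset x.1.updates
    rw [sdiff_self, Finset.bot_eq_empty, Finset.card_empty, zero_add] at h
    rwa [toFinset_foldl_applyList]
  have hl : PolyTime (fun x : {x : Input S U n // truth (conflicts IC x.db = []) ≠ .nil} =>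
      encInput code x.1) (fun x => encList (encFact code) (l x)) :=
    (polyTime_foldl_applyList hcode).reindex Subtype.val
  have hsearch : Tractable (fun x : {x : Input S U n // truth (conflicts IC x.db = []) ≠ .nil} =>
      numUpdates x.1) (fun x => encInput code x.1)
      (fun x => encList (encList (encFact code)) (level IC (l x) (k x))) := by
    refine Tractable.while (fun x i => encList (encList (encFact code)) (level IC (l x) i)) k
      (fun x i => truth (¬ ∃ s ∈ level IC (l x) i, conflicts IC s = []))
      -- A level has at most `d ^ i` nodes, each a sublist of the updated database. With `d + 1` the
      -- bound is monotone in the depth even when `d = 0`.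
      (fun x => (d + 1) ^ numUpdates x.1 * ((encList (encFact code) (l x)).size + 1) + 1)
      (hl.pair .nil).of_polyTime (FPBound.param.mono hkm)
      (((FPBound.pow_param (d + 1)).mul (hl.of_polyTime.size_bound.add (.const 1))).add (.const 1))
      (fun x i hi => ?_) ?_ (fun x i hi => ?_) (fun x => ?_) ?_
    · refine (size_encList_le fun s hs => size_encList_le_of_sublist _
        (sublist_and_card_of_mem_level hs).1).trans ?_
      gcongr
      exact (length_level_le i).trans ((Nat.pow_le_pow_left d.le_succ i).trans
        (Nat.pow_le_pow_right d.succ_pos (hi.trans (hkm x))))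
    · exact .not (.exists_mem (eb := encList (encFact code)) .id
        (hcons.comp (f := Prod.snd) Tractable.id.snd fun _ => le_rfl))
    · simpa using hmin x i hi
    · simpa using hex x
    · exact .flatMap (eb := encList (encFact code)) .id
        ((polyTime_children hcode hle IC).comp (f := Prod.snd) Tractable.id.snd fun _ => le_rfl)
  have hfinal : PolyTime
      (fun p : List (List (Fact S U)) × (Fin n → U) =>
        .cons (encList (encList (encFact code)) p.1) (encTuple code p.2))
      (fun p => truth (∀ s ∈ p.1, ¬ (conflicts IC s = [] ∧ ¬ Q.Holds s.toFinset p.2))) := by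
    refine .forall_mem (eb := encList (encFact code)) Tractable.id.fst (.not (.and
      (hcons.comp (f := Prod.snd) Tractable.id.snd fun _ => le_rfl) (.not ?_)))
    exact .query hcode hle Q Tractable.id.snd Tractable.id.fst.snd
  -- The final test is polynomial in the whole last level, whose size is already bounded in
  -- fixed-parameter form.
  refine (hfinal.comp (f := fun x => (level IC (l x) (k x), x.1.answer))
    (hsearch.pair Tractable.id.snd.snd) fun _ => Nat.zero_le _).congr fun x => ?_
  congr 1
  refine propext ?_
  simp only [incrementalCQA, IsConsistentAnswer, Set.mem_ofPred_eq,
    ← toFinset_foldl_applyList]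
  constructor
  · refine fun h => ⟨hD x, fun D hrep => ?_⟩
    obtain ⟨s, hs, hc, rfl⟩ := (isCRepair_iff_mem_level (hex x) (hmin x)).1 hrep
    by_contra hQ
    exact h s hs ⟨hc, hQ⟩
  · rintro ⟨-, h⟩ s hs ⟨hc, hQ⟩
    exact hQ (h _ ((isCRepair_iff_mem_level (hex x) (hmin x)).2 ⟨s, hs, hc, rfl⟩))

end CQA

theorem mainTheorem5 (S : CQA.Schema) {U : Type*} [LinearOrder U]
    (code : U → CQA.Data) (hcode : Function.Injective code)
    (hle : CQA.InPTIME (CQA.encPair code) {x : U × U | x.1 ≤ x.2})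
    (n : ℕ) (Q : CQA.Query S U n) :
    (∀ F : Finset (CQA.FunctionalDependency S),
      CQA.InFPT (CQA.encInput code) CQA.numUpdates
        (CQA.incrementalCQA (fun D => ∀ φ ∈ F, φ.Holds D) Q)) ∧
    (∀ IC : Finset (CQA.DenialConstraint S U),
      CQA.InFPT (CQA.encInput code) CQA.numUpdates
        (CQA.incrementalCQA (fun D => ∀ φ ∈ IC, φ.Holds D) Q)) := by
  constructor
  · intro F
    have h := (CQA.tractable_incrementalCQA hcode hle Q
      (F.toList.flatMap fun φ => φ.rhs.toList.map φ.toDenial)).inFPT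
    suffices hF : (fun D : CQA.Instance S U => ∀ φ ∈ F, φ.Holds D) = fun D =>
        ∀ φ ∈ F.toList.flatMap fun φ => φ.rhs.toList.map φ.toDenial, φ.Holds D by
      rwa [hF]
    refine funext fun D => propext ⟨fun hF ψ hψ => ?_, fun hF φ hφ => ?_⟩
    · obtain ⟨φ, hφ, hψ⟩ := List.mem_flatMap.1 hψ
      obtain ⟨j, hj, rfl⟩ := List.mem_map.1 hψ
      exact CQA.FunctionalDependency.holds_iff_forall_toDenial.1
        (hF φ (Finset.mem_toList.1 hφ)) j (Finset.mem_toList.1 hj)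
    · exact CQA.FunctionalDependency.holds_iff_forall_toDenial.2 fun j hj =>
        hF _ (List.mem_flatMap.2 ⟨φ, Finset.mem_toList.2 hφ,
          List.mem_map.2 ⟨j, Finset.mem_toList.2 hj, rfl⟩⟩)
  · intro IC
    simpa only [Finset.mem_toList] using
      (CQA.tractable_incrementalCQA hcode hle Q IC.toList).inFPT
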